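/- **Setting.** Let $\Omega\subset\mathbb R^2$ be a bounded polygonal domain with a conforming coarse triangulation $\mathcal T^H$ with mesh size $H<1$, shape regular in the sense that $\operatorname{diam}(K)^2\le\sigma|K|$ for all $K\in\mathcal T^H$. Let $\Omega^\epsilon=\Omega\setminus\mathcal B^\epsilon$ be a perforated domain, triangulated by a conforming fine mesh $\mathcal T^h$ each of whose triangles lies in a coarse one. The perforated coarse elements are $K^\epsilon=K\cap\Omega^\epsilon$ (the union of the fine triangles in $K$); they are assumed path-connected. For a coarse node or a coarse edge $i$, let $\omega_i^\epsilon$ be the union of the $K^\epsilon$ such that $K$ has the node $i$, respectively the edge $i$. *Offline space.* On $\omega_i^\epsilon$ the snapshots are the velocities $u$ of the fine-grid ($P^2$–$P^0$) solutions $(u,p)$ of $$\int_{\omega_i^\epsilon}\nabla u:\nabla v-\int_{\omega_i^\epsilon}p\operatorname{div}v=0,\qquad \int_{\omega_i^\epsilon}q\operatorname{div}u=\int_{\omega_i^\epsilon}c\,q$$ for all fine-grid $v$ vanishing on $\partial\omega_i^\epsilon$ and all fine-grid $q$, with $u=0$ on $\partial\mathcal B^\epsilon$ and $u=(\delta_l,0)$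 or $(0,\delta_l)$ on $\partial\omega_i^\epsilon\setminus\partial\mathcal B^\epsilon$. Here $\delta_l$ is $1$ on one fine boundary edge $e_l$ and $0$ on the others; the condition is imposed at the $P^2$ nodes (at the end points of $e_l$, where $\delta_l$ jumps, any value in $[0,1]$ may be used); $c$ is the constant given by compatibility. Let $\{\chi_i\}$ be a Lipschitz partition of unity on $\overline{\Omega^\epsilon}$ indexed by the coarse nodes and edges, $\chi_i$ vanishing on each coarse triangle and each coarse edge not containing $i$. Let $\widetilde\Phi^i_k$, $1\le k\le M_i$, be linearly independent eigenfunctions for the first $M_i$ eigenvalues, in increasing order, of $$\int_{\omega_i^\epsilon}\nabla w:\nabla z=\lambda\int_{\omega_i^\epsilon}|\nabla\chi_i|^2\,w\cdot z$$ in the span of the snapshots. For $a\in\{1,2\}$ let $g=\chi_i\,(\widetilde\Phi^i_k)_a\,\mathbf e_a$, and let the basis function $\Phi^i_{a,k}$ be, on each $K^\epsilon\subset\omega_i^\epsilon$, the field of least $\|\nabla\Phi\|_{L^2(K^\epsilon)}$ among those $\Phi\in H^1(K^\epsilon)^2$ with $\Phi=g$ on $\partial K^\epsilon$ and $\operatorname{div}\Phi=|K^\epsilon|^{-1}\int_{\partial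 K^\epsilon}g\cdot n\,ds$; it is zero outside $\omega_i^\epsilon$. Let $V_{\rm off}$ be the span of all $\Phi^i_{a,k}$ ($M_i\ge0$ arbitrary), and $Q_{\rm off}$ the space of functions with zero mean on $\Omega^\epsilon$ that are constant on each $K^\epsilon$. *Assumptions.* (i) The continuous inf-sup condition holds with $C_{\rm cont}>0$: for all $p\in L^2(\Omega^\epsilon)$ with zero mean, $$\sup_{v\in H^1_0(\Omega^\epsilon)^2}\frac{\int_{\Omega^\epsilon}\operatorname{div}(v)\,p}{\|v\|_{H^1(\Omega^\epsilon)}}\ge C_{\rm cont}\|p\|_{L^2(\Omega^\epsilon)}.$$ (ii) For each interior coarse edge $E$ (a coarse edge that meets the open set $\Omega^\epsilon$), some basis function $\Phi$ of the edge neighborhood of $E$ satisfies $\int_E\Phi\cdot n\,ds\ne0$ and, once normalized by $\int_E\Phi\cdot n\,ds=1$, has $\int|\nabla\Phi|^2\le C_{\max}$. **Lemma (discrete inf-sup condition).** There is a constant $C_{\rm infsup}>0$, depending only on $C_{\rm cont}$, $C_{\max}$ and $\sigma$, such that in the above setting, for all $p\in Q_{\rm off}$, $$\sup_{u\in V_{\rm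 off}}\frac{\int_{\Omega^\epsilon}\operatorname{div}(u)\,p}{\|u\|_{H^1(\Omega^\epsilon)}}\ge C_{\rm infsup}\|p\|_{L^2(\Omega^\epsilon)}.$$ -/

import Mathlib

open MeasureTheory
open scoped ContDiff

noncomputable section

namespace PerforatedStokes

/-! ## Vector fields, Sobolev jets, `H¹₀` and the inf-sup quotient -/

/-- The Euclidean plane. -/
abbrev Plane := EuclideanSpace ℝ (Fin 2)

/-- Vector fields on the plane, by components. -/
abbrev VField := Plane → Fin 2 → ℝ

/-- Matrix fields on the plane. -/
abbrev MField := Plane → Fin 2 → Fin 2 → ℝ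

/-- A pair `(u, ∇u)`, the entry `∇u x a b` standing for `∂_b u_a (x)`. -/
abbrev Jet := VField × MField

/-- The classical partial derivative `∂_b f`. -/
def partialD (f : Plane → ℝ) (b : Fin 2) (x : Plane) : ℝ :=
  fderiv ℝ f x (EuclideanSpace.single b 1)

/-- The classical gradient of a vector field. -/
def grad (u : VField) : MField := fun x a b => partialD (fun y => u y a) b x

/-- The field together with its classical gradient. -/
def jet (u : VField) : Jet := (u, grad u)

/-- The divergence of a jet (trace of its gradient part). -/
def divJ (J : Jet) (x : Plane) : ℝ := ∑ a, J.2 x a a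

/-- `∫_U |∇u|²`. -/
def energy (U : Set Plane) (J : Jet) : ℝ := ∫ x in U, ∑ a, ∑ b, J.2 x a b ^ 2

/-- The `H¹(U)` norm. -/
def h1norm (U : Set Plane) (J : Jet) : ℝ :=
  Real.sqrt ((∫ x in U, ∑ a, J.1 x a ^ 2) + energy U J)

/-- The `L²(U)` norm of a scalar function. -/
def l2norm (U : Set Plane) (p : Plane → ℝ) : ℝ := Real.sqrt (∫ x in U, p x ^ 2)

/-- Square integrability on `U` of a field and of its gradient part. -/
def JetL2 (U : Set Plane) (J : Jet) : Prop :=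
  (∀ a, MemLp (fun x => J.1 x a) 2 (volume.restrict U)) ∧
    ∀ a b, MemLp (fun x => J.2 x a b) 2 (volume.restrict U)

/-- Smooth vector fields with compact support in `U`. -/
def IsTest (U : Set Plane) (φ : VField) : Prop :=
  ContDiff ℝ ∞ φ ∧ HasCompactSupport φ ∧ tsupport φ ⊆ U

/-- `(H¹₀(U))²` for an open set `U`: the closure of the test fields in the `H¹(U)` norm
(the second component of the jet is then the weak gradient of the first). -/
def H10 (U : Set Plane) : Set Jet :=
  {J | JetL2 U J ∧ ∃ φ : ℕ → VField, (∀ n, IsTest U (φ n)) ∧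
    Filter.Tendsto (fun n => h1norm U (J - jet (φ n))) Filter.atTop (nhds 0)}

/-- `sup_{v ∈ V} (∫_U div(v) p) / ‖v‖_{H¹(U)}`, in the extended reals; the quotient is `0` for
`v = 0`. -/
def infSupQuotient (U : Set Plane) (V : Set Jet) (p : Plane → ℝ) : EReal :=
  ⨆ v ∈ V, (((∫ x in U, divJ v x * p x) / h1norm U v : ℝ) : EReal)

/-- The continuous inf-sup condition on `U` with constant `C`. -/
def ContinuousInfSup (U : Set Plane) (C : ℝ) : Prop :=
  ∀ p : Plane → ℝ, MemLp p 2 (volume.restrict U) → ∫ x in U, p x = 0 →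
    ((C * l2norm U p : ℝ) : EReal) ≤ infSupQuotient U (H10 U) p

/-! ## Fluxes through segments -/

/-- The determinant of two plane vectors. -/
def cross (v w : Plane) : ℝ := v 0 * w 1 - v 1 * w 0

/-- The flux `∫_{[p,q]} g · n ds`, where `n` is the unit normal pointing to the right of the
direction from `p` to `q` (exchanging `p` and `q` changes the sign). -/
def segFlux (p q : Plane) (g : VField) : ℝ :=
  ∫ r in (0 : ℝ)..1,
    (g (p + r • (q - p)) 0 * (q - p) 1 - g (p + r • (q - p)) 1 * (q - p) 0)

/-! ## Meshes -/

/-- The closed convex hull of a finite vertex set. -/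
abbrev hull (s : Finset Plane) : Set Plane := convexHull ℝ (s : Set Plane)

/-- A conforming triangulation in the plane: a finite simplicial complex each of whose faces is a
face of a triangle. -/
structure Triangulation extends Geometry.SimplicialComplex ℝ Plane where
  finite_faces : faces.Finite
  pure_two : ∀ s ∈ faces, ∃ t ∈ faces, s ⊆ t ∧ t.card = 3

namespace Triangulation

/-- The triangles, as vertex sets. -/
def tri (T : Triangulation) : Finset (Finset Plane) :=
  T.finite_faces.toFinset.filter (fun t => t.card = 3)

end Triangulation

open Classical in
/-- The fine triangles contained in the triangle `K`. -/
def fineTris (fine : Triangulation) (K : Finset Plane) : Finset (Finset Plane) :=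
  fine.tri.filter (fun t => hull t ⊆ hull K)

/-- The (closed) perforated coarse element `K^ε`: the union of the fine triangles in `K`. -/
def blockOf (fine : Triangulation) (K : Finset Plane) : Set Plane :=
  ⋃ t ∈ fineTris fine K, hull t

/-- A polygonally bounded perforated domain with its coarse and fine grid. The coarse triangulation
covers the unperforated domain `Ω`; the fine one covers the perforated domain `Ω^ε`, refines the
coarse one, and resolves the perforations. No perforation splits a coarse element, and the coarse
mesh size is less than one. -/
structure PerforatedMesh where
  coarse : Triangulation
  fine : Triangulation
  refines : ∀ t ∈ fine.tri, ∃ K ∈ coarse.tri, hull t ⊆ hull K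
  block_connected : ∀ K ∈ coarse.tri, IsPathConnected (interior (blockOf fine K))
  meshSize_lt_one : ∀ K ∈ coarse.tri, Metric.diam (hull K) < 1

namespace PerforatedMesh

variable (P : PerforatedMesh)

/-- The closure of the perforated domain. -/
def closedDomain : Set Plane := P.fine.space

/-- The perforated domain `Ω^ε` (an open set). -/
def domain : Set Plane := interior P.closedDomain

/-- The boundary of the perforations: the part of the closed perforated domain that is adherent to
the removed set `Ω \ Ω^ε`. -/
def holeBoundary : Set Plane := P.closedDomain ∩ closure (P.coarse.space \ P.closedDomain)

/-- The closed perforated coarse element. -/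
def block (K : Finset Plane) : Set Plane := blockOf P.fine K

/-- The coarse nodes (one vertex) and coarse edges (two vertices). Each carries a neighborhood. -/
def IsNodeOrEdge (s : Finset Plane) : Prop := s ∈ P.coarse.faces ∧ s.card ≤ 2

/-- The interior coarse edges: those that meet the open set `Ω^ε`. -/
def IsInteriorEdge (s : Finset Plane) : Prop :=
  s ∈ P.coarse.faces ∧ s.card = 2 ∧ (hull s ∩ P.domain).Nonempty

/-- The closed coarse neighborhood of a coarse node or edge `s`: the union of all perforated coarse
elements having `s` as a vertex, respectively as an edge. -/
def nbhd (s : Finset Plane) : Set Plane :=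
  ⋃ K ∈ P.coarse.tri, ⋃ (_ : s ⊆ K), P.block K

/-- `t` is a fine triangle of the coarse neighborhood of `s`. -/
def IsFineTriOf (s t : Finset Plane) : Prop :=
  ∃ K ∈ P.coarse.tri, s ⊆ K ∧ t ∈ fineTris P.fine K

/-- Shape regularity of the coarse triangles: `diam(K)² ≤ σ |K|`. -/
def ShapeRegular (σ : ℝ) : Prop :=
  ∀ K ∈ P.coarse.tri, Metric.diam (hull K) ^ 2 ≤ σ * volume.real (hull K)

open Classical in
/-- The outward flux `∫_{∂K^ε} g · n ds` through the polygonal boundary of a perforated coarse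
element. It is the sum over the directed edges `p → q` of its fine triangles that lie on the
boundary, directed so that the triangle is on the left; the outward normal is on the right. -/
def bdryFlux (K : Finset Plane) (g : VField) : ℝ :=
  ∑ t ∈ fineTris P.fine K, ∑ p ∈ t, ∑ q ∈ t,
    if (∃ r ∈ t, 0 < cross (q - p) (r - p)) ∧ segment ℝ p q ⊆ frontier (P.block K)
    then segFlux p q g else 0

/-! ### The fine-grid Stokes spaces on a coarse neighborhood -/

/-- Continuous piecewise quadratic velocities on the fine grid of the neighborhood of `s` that
vanish on the perforations (and are extended by zero outside of the neighborhood). -/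
def IsVh (s : Finset Plane) (u : VField) : Prop :=
  ContinuousOn u (P.nbhd s) ∧
  (∀ t, P.IsFineTriOf s t → ∀ a, ∃ f : MvPolynomial (Fin 2) ℝ, f.totalDegree ≤ 2 ∧
    ∀ x ∈ hull t, u x a = MvPolynomial.eval (fun i => x i) f) ∧
  (∀ x ∈ P.nbhd s ∩ P.holeBoundary, u x = 0) ∧
  ∀ x, x ∉ P.nbhd s → u x = 0

/-- The fine-grid velocities that vanish on the boundary of the neighborhood. -/
def IsVh0 (s : Finset Plane) (v : VField) : Prop :=
  P.IsVh s v ∧ ∀ x ∈ frontier (P.nbhd s), v x = 0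

/-- Piecewise constant pressures on the fine grid of the neighborhood of `s`. -/
def IsQh (s : Finset Plane) (q : Plane → ℝ) : Prop :=
  ∀ t, P.IsFineTriOf s t → ∃ c : ℝ, ∀ x ∈ interior (hull t), q x = c

/-- The fine-grid edges on the boundary of the neighborhood of `s` that are not on the boundary of
the perforations. -/
def IsBdryEdge (s e : Finset Plane) : Prop :=
  e.card = 2 ∧ (∃ t, P.IsFineTriOf s t ∧ e ⊆ t) ∧
    hull e ⊆ frontier (P.nbhd s) ∧ ¬ hull e ⊆ P.holeBoundary

/-- The boundary condition `u = δ_e 𝐞_a` on the boundary of the neighborhood of `s` off the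
perforations, imposed on the fine grid. Here `δ_e` is the piecewise constant function with value `1`
on the fine edge `e` and `0` on the others. The nodes of the quadratic element are the vertices and
the edge midpoints; the condition is imposed at all of these nodes where `δ_e` is single valued; at
the two end points of `e`, where `δ_e` jumps, any value between `0` and `1` is allowed. -/
def SnapshotBC (s e : Finset Plane) (a : Fin 2) (u : VField) : Prop :=
  (∀ x ∈ frontier (P.nbhd s), ∀ b, b ≠ a → u x b = 0) ∧
  (∀ x y, P.IsBdryEdge s {x, y} →
    (({x, y} : Set Plane) = (e : Set Plane) → u (midpoint ℝ x y) a = 1) ∧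
    (({x, y} : Set Plane) ≠ (e : Set Plane) → u (midpoint ℝ x y) a = 0)) ∧
  (∀ t, P.IsFineTriOf s t → ∀ x ∈ t, x ∈ frontier (P.nbhd s) →
    (x ∉ e → u x a = 0) ∧ (x ∈ e → 0 ≤ u x a ∧ u x a ≤ 1))

/-- `u` is the velocity of a snapshot: with some pressure it solves the fine-grid Stokes problem on
the neighborhood of `s` with boundary datum `δ_e 𝐞_a` and constant divergence source `c`. The value
of `c` is forced by the choice `q = 1` (the compatibility condition). -/
def IsSnapshot (s e : Finset Plane) (a : Fin 2) (u : VField) : Prop :=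
  P.IsVh s u ∧ P.SnapshotBC s e a u ∧
  ∃ (p : Plane → ℝ) (c : ℝ), P.IsQh s p ∧
    (∀ v, P.IsVh0 s v →
      (∫ x in P.nbhd s, ∑ i, ∑ j, grad u x i j * grad v x i j)
        - ∫ x in P.nbhd s, p x * divJ (jet v) x = 0) ∧
    (∀ q, P.IsQh s q →
      ∫ x in P.nbhd s, q x * divJ (jet u) x = ∫ x in P.nbhd s, c * q x)

/-- A partition of unity on the perforated domain with respect to the coarse nodes and the
(midpoints of the) coarse edges: Lipschitz functions with sum one, the function of `s` vanishing on
every coarse triangle and every coarse edge that does not contain `s`. -/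
structure PartitionOfUnity where
  χ : Finset Plane → Plane → ℝ
  lipschitz : ∀ s, P.IsNodeOrEdge s → ∃ L, LipschitzOnWith L (χ s) P.closedDomain
  vanish : ∀ s, P.IsNodeOrEdge s → ∀ F ∈ P.coarse.faces, ¬ s ⊆ F →
    ∀ x ∈ hull F ∩ P.closedDomain, χ s x = 0
  sum_eq_one : ∀ x ∈ P.closedDomain,
    ∑ s ∈ P.coarse.finite_faces.toFinset.filter (fun s => s.card ≤ 2), χ s x = 1

/-- The bilinear form `a_s(u, v) = ∫ ∇u : ∇v` on the neighborhood of `s`. -/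
def aForm (s : Finset Plane) (u v : VField) : ℝ :=
  ∫ x in P.nbhd s, ∑ i, ∑ j, grad u x i j * grad v x i j

/-- The bilinear form `s_s(u, v) = ∫ |∇χ|² u · v` on the neighborhood of `s`. -/
def sForm (χ : Plane → ℝ) (s : Finset Plane) (u v : VField) : ℝ :=
  ∫ x in P.nbhd s, (∑ b, partialD χ b x ^ 2) * ∑ i, u x i * v x i

/-- An eigenpair of the local spectral problem `a_s(w, z) = μ s_s(w, z)` in the space `W`. -/
def IsEigenpair (χ : Plane → ℝ) (s : Finset Plane) (W : Submodule ℝ VField) (μ : ℝ)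
    (w : VField) : Prop :=
  w ∈ W ∧ w ≠ 0 ∧ ∀ z ∈ W, P.aForm s w z = μ * P.sForm χ s w z

/-- The field `χ w_a 𝐞_a`, where `w_a` is the component of `w` in the direction `a`. -/
def cutoff (χ : Plane → ℝ) (w : VField) (a : Fin 2) : VField :=
  fun x b => if b = a then χ x * w x a else 0

/-- The admissible set of the local optimization problem on the perforated coarse element `K`:
fields in `H¹(K^ε)` with boundary values `g` and constant divergence `|K^ε|⁻¹ ∫_{∂K^ε} g · n`. -/
def StokesAdmissible (K : Finset Plane) (g : VField) (J : Jet) : Prop :=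
  J - jet g ∈ H10 (interior (P.block K)) ∧
  ∀ᵐ x ∂(volume.restrict (P.block K)),
    divJ J x = (volume.real (P.block K))⁻¹ * P.bdryFlux K g

/-- `J` is the Stokes extension of `g` from the boundaries of the coarse elements in the
neighborhood of `s`: on each of them it minimizes the energy among all admissible fields, and it is
zero outside of the neighborhood. -/
def IsStokesExtension (s : Finset Plane) (g : VField) (J : Jet) : Prop :=
  (∀ x, x ∉ P.nbhd s → J.1 x = 0 ∧ J.2 x = 0) ∧
  ∀ K ∈ P.coarse.tri, s ⊆ K →
    P.StokesAdmissible K g J ∧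
    ∀ J', P.StokesAdmissible K g J' → energy (P.block K) J ≤ energy (P.block K) J'

/-- The data produced by the offline stage for the Stokes problem. For every coarse node or edge
`s` the number `M s` of basis functions is arbitrary (possibly zero, in which case nothing is
computed on the neighborhood of `s`). -/
structure OfflineData where
  pou : P.PartitionOfUnity
  /-- number of eigenfunctions that are kept on the neighborhood of `s` -/
  M : Finset Plane → ℕ
  /-- snapshot with boundary datum `δ_e 𝐞_a` -/
  snap : Finset Plane → Finset Plane → Fin 2 → VField
  snap_spec : ∀ s, P.IsNodeOrEdge s → 0 < M s → ∀ e, P.IsBdryEdge s e → ∀ a,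
    P.IsSnapshot s e a (snap s e a)
  eigval : Finset Plane → ℕ → ℝ
  eigfun : Finset Plane → ℕ → VField
  /-- the first `M s` eigenpairs, in increasing order, of the spectral problem in the snapshot
  space of the neighborhood of `s` -/
  eig_spec : ∀ s, P.IsNodeOrEdge s → ∀ k < M s,
    P.IsEigenpair (pou.χ s) s
      (Submodule.span ℝ {w | ∃ e a, P.IsBdryEdge s e ∧ w = snap s e a})
      (eigval s k) (eigfun s k)
  eig_indep : ∀ s, P.IsNodeOrEdge s →
    LinearIndependent ℝ (fun k : Fin (M s) => eigfun s k)
  eig_mono : ∀ s, P.IsNodeOrEdge s → ∀ k l, k ≤ l → l < M s → eigval s k ≤ eigval s l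
  eig_first : ∀ s, P.IsNodeOrEdge s → ∀ μ w,
    P.IsEigenpair (pou.χ s) s
      (Submodule.span ℝ {w | ∃ e a, P.IsBdryEdge s e ∧ w = snap s e a}) μ w →
    w ∉ Submodule.span ℝ {z | ∃ k < M s, z = eigfun s k} →
    ∀ k < M s, eigval s k ≤ μ
  /-- the offline basis function obtained from the `a`-th component of the `k`-th eigenfunction -/
  basis : Finset Plane → ℕ → Fin 2 → Jet
  basis_spec : ∀ s, P.IsNodeOrEdge s → ∀ k < M s, ∀ a,
    P.IsStokesExtension s (cutoff (pou.χ s) (eigfun s k) a) (basis s k a)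

namespace OfflineData

variable {P}
variable (O : P.OfflineData)

/-- The offline velocity space. -/
def Voff : Submodule ℝ Jet :=
  Submodule.span ℝ {J | ∃ s k a, P.IsNodeOrEdge s ∧ k < O.M s ∧ J = O.basis s k a}

/-- The flux through the coarse edge `[p, q]` of a basis function of the neighborhood of `s`. On
the boundaries of the coarse elements the basis function has the boundary values
`χ_s w_a 𝐞_a` (which are continuous, and zero in the perforations). -/
def edgeFlux (s : Finset Plane) (k : ℕ) (a : Fin 2) (p q : Plane) : ℝ :=
  segFlux p q (cutoff (O.pou.χ s) (O.eigfun s k) a)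

/-- Every interior coarse edge `E` has, among the basis functions of its neighborhood, one with
nonzero flux through `E`; its energy is at most `Cmax` once its flux is normalized to be one. -/
def FluxCondition (Cmax : ℝ) : Prop :=
  ∀ s p q, P.IsInteriorEdge s → (s : Set Plane) = {p, q} →
    ∃ k < O.M s, ∃ a, O.edgeFlux s k a p q ≠ 0 ∧
      energy (P.nbhd s) (O.basis s k a) ≤ Cmax * O.edgeFlux s k a p q ^ 2

end OfflineData

/-- The coarse pressure space: functions on `Ω^ε` that are constant on every perforated coarse
element and have zero mean. -/
def Qoff : Set (Plane → ℝ) :=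
  {p | (∀ K ∈ P.coarse.tri, ∃ c : ℝ, ∀ x ∈ interior (P.block K), p x = c) ∧
    ∫ x in P.domain, p x = 0}

end PerforatedMesh

end PerforatedStokes

end

/-! The argument is Fortin's: replace the velocity given by the continuous inf-sup condition by an
offline velocity with the same pairing against every coarse pressure, at the cost of a controlled
factor in the `H¹` norm.

By density the continuous velocity may be taken to be a test field `φ` on the perforated domain
(`exists_isTest_of_lt_quotient`). For every interior coarse edge `E` let `Φ_E` be the basis function
of the flux condition, and set `u = ∑_E (∫_E φ·n / ∫_E Φ_E·n) Φ_E`. A coarse pressure is constant on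
each perforated element, so only the mean divergence on each element matters. It is computed on the
full coarse triangle: both `φ` and the boundary data `χ w_a 𝐞_a`, extended by zero, are Lipschitz on
the plane and vanish in the perforations (`exists_lipschitzWith_cutoff`), so the divergence theorem
on the triangle involves only its three sides (`setIntegral_div_triangle`). The cut-off of `E` has
flux through `E` alone, because the partition function vanishes on the other sides, and the passage
from the boundary data to the Stokes extension adds a field in `H¹₀` of the element, whose mean
divergence is zero. Hence `u` and `φ` have equal mean divergence on each element
(`OfflineData.exists_mem_Voff`).

The norm bound has three ingredients. A trace inequality bounds the squared flux through a side by
`2σ` times the squared `H¹` norm on the triangle (`segFlux_sq_le`); it follows from the divergence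
theorem for a field radial from the opposite vertex. A Poincaré inequality bounds the squared `H¹`
norm of a basis function by `17` times its energy (`IsStokesExtension.integral_sqJ_le`), since an
edge neighborhood lies in a strip of width two. Finally at most three edge functions overlap at
almost every point (`integral_sqJ_sum_le`). -/

noncomputable section

namespace PerforatedStokes

/-! ## Barycentric coordinates of a triangle -/

/-- The barycentric coordinate of `x` belonging to the vertex `r` of the triangle `p q r`. -/
def bary (p q r x : Plane) : ℝ := cross (q - p) (x - p) / cross (q - p) (r - p)

/-- Twice the signed area is invariant under cyclic permutation, so the three barycentric
coordinates share one denominator. -/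
lemma cross_rotate (p q r : Plane) : cross (r - q) (p - q) = cross (q - p) (r - p) := by
  simp only [cross, PiLp.sub_apply]; ring

lemma bary_sum {p q r : Plane} (h : cross (q - p) (r - p) ≠ 0) (x : Plane) :
    bary q r p x + bary r p q x + bary p q r x = 1 := by
  simp only [bary, ← cross_rotate r p q, cross_rotate p q r]
  rw [← add_div, ← add_div, div_eq_one_iff_eq h]
  simp only [cross, PiLp.sub_apply]; ring

lemma bary_combination {p q r : Plane} (h : cross (q - p) (r - p) ≠ 0) (x : Plane) :
    x = bary q r p x • p + bary r p q x • q + bary p q r x • r := by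
  have hs := bary_sum h x
  simp only [bary, ← cross_rotate r p q, cross_rotate p q r] at hs ⊢
  ext i
  simp only [PiLp.add_apply, PiLp.smul_apply, smul_eq_mul]
  rw [div_mul_eq_mul_div, div_mul_eq_mul_div, div_mul_eq_mul_div, ← add_div, ← add_div,
    eq_div_iff h]
  fin_cases i <;> simp only [cross, PiLp.sub_apply, Fin.zero_eta, Fin.mk_one] <;> ring

lemma bary_affine {p q r : Plane} {x y : Plane} {a b : ℝ} (hab : a + b = 1) :
    bary p q r (a • x + b • y) = a * bary p q r x + b * bary p q r y := by
  obtain rfl : b = 1 - a := by linarith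
  simp only [bary]
  rw [mul_div_assoc', mul_div_assoc', ← add_div]
  congr 1
  simp only [cross, PiLp.sub_apply, PiLp.add_apply, PiLp.smul_apply, smul_eq_mul]
  ring

lemma bary_self {p q r : Plane} (h : cross (q - p) (r - p) ≠ 0) : bary p q r r = 1 :=
  div_self h

lemma bary_left (p q r : Plane) : bary p q r p = 0 := by simp [bary, cross]

lemma bary_right (p q r : Plane) : bary p q r q = 0 := by
  simp only [bary, cross]; rw [mul_comm, sub_self, zero_div]

lemma continuous_bary (p q r : Plane) : Continuous (bary p q r) := by
  unfold bary cross
  fun_prop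

lemma convex_bary_nonneg (p q r : Plane) : Convex ℝ {x | 0 ≤ bary p q r x} := by
  intro x hx y hy a b ha hb hab
  simp only [Set.mem_ofPred_eq] at *
  rw [bary_affine hab]
  positivity

lemma mem_triangle_iff {p q r : Plane} (h : cross (q - p) (r - p) ≠ 0) (x : Plane) :
    x ∈ convexHull ℝ ({p, q, r} : Set Plane) ↔
      0 ≤ bary q r p x ∧ 0 ≤ bary r p q x ∧ 0 ≤ bary p q r x := by
  have h1 : cross (r - q) (p - q) ≠ 0 := by rwa [cross_rotate]
  have h2 : cross (p - r) (q - r) ≠ 0 := by rwa [cross_rotate]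
  constructor
  · intro hx
    have key : ∀ a b c : Plane, cross (b - a) (c - a) ≠ 0 →
        ({a, b, c} : Set Plane) = {p, q, r} → 0 ≤ bary a b c x := by
      intro a b c habc he
      refine (convexHull_min (t := {x | 0 ≤ bary a b c x}) ?_ (convex_bary_nonneg a b c)) (he ▸ hx)
      rintro y (rfl | rfl | rfl)
      · simp [bary_left]
      · simp [bary_right]
      · simp [bary_self habc]
    refine ⟨key _ _ _ h1 ?_, key _ _ _ h2 ?_, key _ _ _ h rfl⟩ <;> grind
  · rintro ⟨hp, hq, hr⟩
    rw [bary_combination h x]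
    have hs := bary_sum h x
    have hc := convex_convexHull ℝ ({p, q, r} : Set Plane)
    have := hc.sum_mem (t := Finset.univ) (w := ![bary q r p x, bary r p q x, bary p q r x])
      (z := ![p, q, r]) (by intro i _; fin_cases i <;> simpa)
      (by simpa [Fin.sum_univ_three] using hs)
      (by intro i _; fin_cases i <;> exact subset_convexHull ℝ _ (by simp))
    simpa [Fin.sum_univ_three] using this

lemma mem_interior_triangle {p q r : Plane} (h : cross (q - p) (r - p) ≠ 0) {x : Plane}
    (hp : 0 < bary q r p x) (hq : 0 < bary r p q x) (hr : 0 < bary p q r x) :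
    x ∈ interior (convexHull ℝ ({p, q, r} : Set Plane)) := by
  rw [mem_interior]
  refine ⟨{x | 0 < bary q r p x} ∩ {x | 0 < bary r p q x} ∩ {x | 0 < bary p q r x}, ?_, ?_, ?_⟩
  · rintro y ⟨⟨h1, h2⟩, h3⟩
    exact (mem_triangle_iff h y).2 ⟨h1.le, h2.le, h3.le⟩
  · refine ((isOpen_lt continuous_const (continuous_bary _ _ _)).inter
      (isOpen_lt continuous_const (continuous_bary _ _ _))).inter
      (isOpen_lt continuous_const (continuous_bary _ _ _))
  · exact ⟨⟨hp, hq⟩, hr⟩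

/-- From an interior point one can move a little in the direction `p - r` without leaving the
triangle. The coordinate of `r` decreases at unit rate and is still nonnegative afterwards. -/
lemma bary_pos_of_mem_interior {p q r : Plane} (h : cross (q - p) (r - p) ≠ 0) {x : Plane}
    (hx : x ∈ interior (convexHull ℝ ({p, q, r} : Set Plane))) : 0 < bary p q r x := by
  have hc : Continuous fun η : ℝ => x - η • (r - p) := by fun_prop
  have h0 : (fun η : ℝ => x - η • (r - p)) 0 ∈ interior (convexHull ℝ ({p, q, r} : Set Plane)) := by
    simpa using hx
  have hev : ∀ᶠ η : ℝ in nhdsWithin 0 (Set.Ioi 0),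
      x - η • (r - p) ∈ interior (convexHull ℝ ({p, q, r} : Set Plane)) :=
    nhdsWithin_le_nhds (hc.continuousAt.eventually_mem (isOpen_interior.mem_nhds h0))
  obtain ⟨η, hη, hη0⟩ := (hev.and self_mem_nhdsWithin).exists
  have h3 := ((mem_triangle_iff h _).1 (interior_subset hη)).2.2
  have : bary p q r (x - η • (r - p)) = bary p q r x - η := by
    simp only [bary]
    rw [eq_sub_iff_add_eq, div_add' _ _ _ h]
    congr 1
    simp only [cross, PiLp.sub_apply, PiLp.smul_apply, smul_eq_mul]
    ring
  have hη0 : (0 : ℝ) < η := hη0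
  linarith

/-- The closed reference triangle. -/
def refTri : Set (ℝ × ℝ) := {z | 0 ≤ z.1 ∧ 0 ≤ z.2 ∧ z.1 + z.2 ≤ 1}

lemma isCompact_refTri : IsCompact refTri := by
  refine (isCompact_Icc (a := ((0 : ℝ), (0 : ℝ))) (b := (1, 1))).of_isClosed_subset ?_ ?_
  · refine (isClosed_le continuous_const continuous_fst).inter
      ((isClosed_le continuous_const continuous_snd).inter
        (isClosed_le (continuous_fst.add continuous_snd) continuous_const))
  · rintro ⟨x, y⟩ ⟨h1, h2, h3⟩
    simp only at h1 h2 h3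
    exact ⟨⟨h1, h2⟩, ⟨by simp only; linarith, by simp only; linarith⟩⟩

/-- Affine change of variables. The reference triangle lives in `ℝ × ℝ` rather than in `Plane` so
that Fubini applies directly. -/
lemma setIntegral_triangle {a b c : Plane} (h : cross (b - a) (c - a) ≠ 0) (f : Plane → ℝ) :
    ∫ x in convexHull ℝ ({a, b, c} : Set Plane), f x =
      |cross (b - a) (c - a)| *
        ∫ z in refTri, f (a + z.1 • (b - a) + z.2 • (c - a)) := by
  set u := b - a with hu
  set v := c - a with hv
  let e : ℝ × ℝ → Plane := fun z => WithLp.toLp 2 ![z.1, z.2]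
  have he : MeasurePreserving e volume volume :=
    (PiLp.volume_preserving_toLp (Fin 2)).comp (volume_preserving_finTwoArrow ℝ).symm
  have hemb : MeasurableEmbedding e :=
    (MeasurableEquiv.toLp 2 (Fin 2 → ℝ)).measurableEmbedding.comp
      (MeasurableEquiv.finTwoArrow (α := ℝ)).symm.measurableEmbedding
  let S : Set Plane := {x | 0 ≤ x 0 ∧ 0 ≤ x 1 ∧ x 0 + x 1 ≤ 1}
  have hS : MeasurableSet S := by
    have h0 : Continuous fun x : Plane => x 0 := by fun_prop
    have h1 : Continuous fun x : Plane => x 1 := by fun_prop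
    exact ((isClosed_le continuous_const h0).inter
      ((isClosed_le continuous_const h1).inter
        (isClosed_le (h0.add h1) continuous_const))).measurableSet
  let A : Plane →L[ℝ] Plane :=
    (EuclideanSpace.proj (0 : Fin 2) : Plane →L[ℝ] ℝ).smulRight u +
      (EuclideanSpace.proj (1 : Fin 2) : Plane →L[ℝ] ℝ).smulRight v
  have hA : ∀ x, A x = x 0 • u + x 1 • v := fun x => by simp [A]
  have hdet : A.det = cross u v := by
    change LinearMap.det (A : Plane →ₗ[ℝ] Plane) = _
    rw [← LinearMap.det_toMatrix (EuclideanSpace.basisFun (Fin 2) ℝ).toBasis, Matrix.det_fin_two]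
    simp [LinearMap.toMatrix_apply, hA, cross]
    ring
  let F : Plane → Plane := fun x => a + A x
  have himg : F '' S = convexHull ℝ ({a, b, c} : Set Plane) := by
    ext x
    rw [mem_triangle_iff h]
    have hx := bary_combination h x
    have hs := bary_sum h x
    constructor
    · rintro ⟨y, ⟨h0, h1, h2⟩, rfl⟩
      have e1 : bary a b c (F y) = y 1 := by
        rw [bary, div_eq_iff h]
        simp only [F, hA, cross, hu, hv, PiLp.sub_apply, PiLp.add_apply, PiLp.smul_apply,
          smul_eq_mul]
        ring
      have e2 : bary c a b (F y) = y 0 := by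
        rw [bary, div_eq_iff (by rwa [← cross_rotate, cross_rotate, ← cross_rotate c a b])]
        simp only [F, hA, cross, hu, hv, PiLp.sub_apply, PiLp.add_apply, PiLp.smul_apply,
          smul_eq_mul]
        ring
      have hs := bary_sum h (F y)
      rw [e1, e2] at *
      refine ⟨by linarith, h0, h1⟩
    · rintro ⟨h1, h2, h3⟩
      refine ⟨WithLp.toLp 2 ![bary c a b x, bary a b c x], ⟨?_, ?_, ?_⟩, ?_⟩
      · simpa
      · simpa
      · simp; linarith
      · simp only [F, hA, hu, hv]
        conv_rhs => rw [hx]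
        obtain hb : bary b c a x = 1 - bary c a b x - bary a b c x := by linarith
        rw [hb]
        simp
        module
  have hinj : Set.InjOn F S := by
    intro x _ y _ hxy
    have hxy : A x = A y := add_left_cancel hxy
    rw [hA, hA] at hxy
    have i0 := congrArg (fun z : Plane => z 0) hxy
    have i1 := congrArg (fun z : Plane => z 1) hxy
    simp only [PiLp.add_apply, PiLp.smul_apply, smul_eq_mul] at i0 i1
    have c0 : (x 0 - y 0) * cross u v = 0 := by
      simp only [cross]; linear_combination v 1 * i0 - v 0 * i1
    have c1 : (x 1 - y 1) * cross u v = 0 := by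
      simp only [cross]; linear_combination u 0 * i1 - u 1 * i0
    have d0 := (mul_eq_zero.1 c0).resolve_right h
    have d1 := (mul_eq_zero.1 c1).resolve_right h
    ext i
    fin_cases i
    · simpa [sub_eq_zero] using d0
    · simpa [sub_eq_zero] using d1
  have hF : ∀ x ∈ S, HasFDerivWithinAt F A S x := fun x _ =>
    (A.hasFDerivAt.const_add a).hasFDerivWithinAt
  rw [← himg, integral_image_eq_integral_abs_det_fderiv_smul volume hS hF hinj, hdet]
  simp only [smul_eq_mul]
  rw [integral_const_mul]
  congr 1
  rw [← he.setIntegral_preimage_emb hemb]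
  have : e ⁻¹' S = refTri := by ext z; simp [e, S, refTri]
  rw [this]
  simp [F, hA, e, add_assoc]

/-! ## The divergence theorem on a triangle for Lipschitz fields -/

lemma integral_refTri {h : ℝ × ℝ → ℝ} (hb : ∃ C, ∀ z, |h z| ≤ C)
    (hm : Measurable h) :
    ∫ z in refTri, h z = ∫ t in (0 : ℝ)..1, ∫ r in (0 : ℝ)..(1 - t), h (r, t) := by
  obtain ⟨C, hC⟩ := hb
  have hms := isCompact_refTri.isClosed.measurableSet
  have hint : Integrable (refTri.indicator h) (volume : Measure (ℝ × ℝ)) := by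
    rw [integrable_indicator_iff hms]
    exact Measure.integrableOn_of_bounded (M := C) isCompact_refTri.measure_lt_top.ne
      hm.aestronglyMeasurable (Filter.Eventually.of_forall hC)
  rw [← integral_indicator hms]
  rw [Measure.volume_eq_prod] at hint ⊢
  rw [integral_prod_symm _ hint, intervalIntegral.integral_of_le zero_le_one,
    ← integral_Icc_eq_integral_Ioc, ← integral_indicator measurableSet_Icc]
  congr 1
  ext t
  by_cases ht : t ∈ Set.Icc (0 : ℝ) 1
  · rw [Set.indicator_of_mem ht, intervalIntegral.integral_of_le (by linarith [ht.2]),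
      ← integral_Icc_eq_integral_Ioc, ← integral_indicator measurableSet_Icc]
    congr 1
    ext r
    have h0 := ht.1
    by_cases hr : r ∈ Set.Icc 0 (1 - t)
    · rw [Set.indicator_of_mem hr, Set.indicator_of_mem]
      exact ⟨hr.1, h0, by have := hr.2; simp only; linarith⟩
    · rw [Set.indicator_of_notMem hr, Set.indicator_of_notMem]
      rintro ⟨h1, h2, h3⟩
      exact hr ⟨h1, by simp only at h3; linarith⟩
  · rw [Set.indicator_of_notMem ht]
    have : ∀ r, refTri.indicator h (r, t) = 0 := by
      intro r
      apply Set.indicator_of_notMem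
      rintro ⟨h1, h2, h3⟩
      simp only at h1 h2 h3
      exact ht ⟨h2, by linarith⟩
    simp [this]

/-- Fubini, with the inner integral along `u`. On each line the directional derivative is the
derivative of a Lipschitz, hence absolutely continuous, function of one variable, so the fundamental
theorem of calculus holds on every line and no smoothness is needed. -/
lemma integral_refTri_lineDeriv {f : Plane → ℝ} {C : NNReal} (hf : LipschitzWith C f)
    (a u v : Plane) :
    ∫ z in refTri, lineDeriv ℝ f (a + z.1 • u + z.2 • v) u =
      ∫ t in (0 : ℝ)..1, (f (a + (1 - t) • u + t • v) - f (a + t • v)) := by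
  rw [integral_refTri (h := fun z => lineDeriv ℝ f (a + z.1 • u + z.2 • v) u)]
  · congr 1
    ext t
    have hd : ∀ r : ℝ, lineDeriv ℝ f (a + r • u + t • v) u =
        deriv (fun ρ : ℝ => f (a + ρ • u + t • v)) r := by
      intro r
      rw [lineDeriv]
      have : (fun s : ℝ => f (a + r • u + t • v + s • u)) =
          fun s : ℝ => (fun ρ : ℝ => f (a + ρ • u + t • v)) (r + s) := by
        ext s; congr 1; module
      rw [this, deriv_comp_const_add (fun ρ : ℝ => f (a + ρ • u + t • v)), add_zero]
    simp only [hd]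
    rw [AbsolutelyContinuousOnInterval.integral_deriv_eq_sub]
    · simp
    · refine LipschitzOnWith.absolutelyContinuousOnInterval (K := C * ‖u‖₊) ?_
      refine LipschitzWith.lipschitzOnWith (hf.comp (LipschitzWith.of_dist_le_mul fun x y => ?_))
      rw [dist_eq_norm, dist_eq_norm]
      have : a + x • u + t • v - (a + y • u + t • v) = (x - y) • u := by module
      rw [this, norm_smul, mul_comm]; rfl
  · exact ⟨C * ‖u‖, fun z => norm_lineDeriv_le_of_lipschitz ℝ hf⟩
  · exact (measurable_lineDeriv hf.continuous).comp (by fun_prop)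

lemma integral_refTri_swap (h : ℝ × ℝ → ℝ) :
    ∫ z in refTri, h z = ∫ z in refTri, h z.swap := by
  rw [Measure.volume_eq_prod,
    ← (Measure.measurePreserving_swap (μ := (volume : Measure ℝ))
    (ν := (volume : Measure ℝ))).setIntegral_preimage_emb
    (MeasurableEquiv.prodComm (α := ℝ) (β := ℝ)).measurableEmbedding h refTri]
  have : Prod.swap ⁻¹' refTri = refTri := by
    ext ⟨x, y⟩
    simp only [refTri, Set.mem_preimage, Set.mem_ofPred_eq, Prod.swap]
    constructor <;> rintro ⟨h1, h2, h3⟩ <;> exact ⟨h2, h1, by linarith⟩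
  rw [this]

lemma LipschitzWith.component {φ : VField} {C : NNReal} (hφ : LipschitzWith C φ) (a : Fin 2) :
    LipschitzWith C (fun x => φ x a) := by
  have := (LipschitzWith.eval (α := fun _ : Fin 2 => ℝ) a).comp hφ
  rw [one_mul] at this
  exact this

lemma fderiv_apply_plane (f : Plane → ℝ) (x w : Plane) :
    fderiv ℝ f x w = w 0 * partialD f 0 x + w 1 * partialD f 1 x := by
  have : w = w 0 • EuclideanSpace.single 0 (1 : ℝ) + w 1 • EuclideanSpace.single 1 (1 : ℝ) := by
    ext i; fin_cases i <;> simp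
  conv_lhs => rw [this]
  simp [partialD]

lemma divJ_jet (φ : VField) (x : Plane) :
    divJ (jet φ) x = partialD (fun y => φ y 0) 0 x + partialD (fun y => φ y 1) 1 x := by
  simp [divJ, jet, grad]

lemma segFlux_swap (p q : Plane) (g : VField) : segFlux q p g = - segFlux p q g := by
  unfold segFlux
  rw [← intervalIntegral.integral_neg]
  have := intervalIntegral.integral_comp_sub_left (a := 0) (b := 1) (fun r : ℝ =>
    -(g (p + r • (q - p)) 0 * (q - p) 1 - g (p + r • (q - p)) 1 * (q - p) 0)) 1
  simp only [sub_zero, sub_self] at this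
  rw [← this]
  congr 1
  ext r
  have h : p + (1 - r) • (q - p) = q + r • (p - q) := by module
  rw [h]
  simp only [PiLp.sub_apply]
  ring

theorem setIntegral_div_triangle {φ : VField} {C : NNReal} (hφ : LipschitzWith C φ) {a b c : Plane}
    (h : cross (b - a) (c - a) ≠ 0) :
    ∫ x in convexHull ℝ ({a, b, c} : Set Plane), divJ (jet φ) x =
      |cross (b - a) (c - a)| / cross (b - a) (c - a) *
        (segFlux a b φ + segFlux b c φ + segFlux c a φ) := by
  set u := b - a with hu
  set v := c - a with hv
  have hl0 := LipschitzWith.component hφ 0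
  have hl1 := LipschitzWith.component hφ 1
  have mkLip : ∀ α β : ℝ, ∃ C', LipschitzWith C' fun x => α * φ x 0 + β * φ x 1 := fun α β =>
    ⟨_, ((lipschitzWith_smul α).comp hl0).add ((lipschitzWith_smul β).comp hl1)⟩
  obtain ⟨CA, hA⟩ := mkLip (v 1) (-v 0)
  obtain ⟨CB, hB⟩ := mkLip (-u 1) (u 0)
  -- `A` and `B` are the components of `φ`, up to scaling by `cross u v`, in the frame `(u, v)`:
  -- almost everywhere `cross u v * div φ = ∂_u A + ∂_v B`. Each term is integrated along its own
  -- direction.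
  set A : Plane → ℝ := fun x => v 1 * φ x 0 + -v 0 * φ x 1 with hAdef
  set B : Plane → ℝ := fun x => -u 1 * φ x 0 + u 0 * φ x 1 with hBdef
  have hae : ∀ᵐ x ∂(volume.restrict (convexHull ℝ ({a, b, c} : Set Plane))),
      divJ (jet φ) x = (cross u v)⁻¹ * (lineDeriv ℝ A x u + lineDeriv ℝ B x v) := by
    apply ae_restrict_of_ae
    filter_upwards [hl0.ae_differentiableAt, hl1.ae_differentiableAt] with x d0 d1
    rw [eq_inv_mul_iff_mul_eq₀ h]
    have eA : HasFDerivAt A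
        (v 1 • fderiv ℝ (fun y => φ y 0) x + (-v 0) • fderiv ℝ (fun y => φ y 1) x) x :=
      (d0.hasFDerivAt.const_mul _).add (d1.hasFDerivAt.const_mul _)
    have eB : HasFDerivAt B
        (-u 1 • fderiv ℝ (fun y => φ y 0) x + (u 0) • fderiv ℝ (fun y => φ y 1) x) x :=
      (d0.hasFDerivAt.const_mul _).add (d1.hasFDerivAt.const_mul _)
    rw [(eA.hasLineDerivAt u).lineDeriv, (eB.hasLineDerivAt v).lineDeriv, divJ_jet]
    simp only [add_apply, smul_apply, smul_eq_mul,
      fderiv_apply_plane, cross]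
    ring
  have hbd : ∀ (f : Plane → ℝ) (C' : NNReal) (w : Plane), LipschitzWith C' f →
      IntegrableOn (fun z : ℝ × ℝ => lineDeriv ℝ f (a + z.1 • u + z.2 • v) w) refTri := by
    intro f C' w hf
    exact Measure.integrableOn_of_bounded (M := C' * ‖w‖) isCompact_refTri.measure_lt_top.ne
      ((measurable_lineDeriv hf.continuous).comp (by fun_prop)).aestronglyMeasurable
      (Filter.Eventually.of_forall fun z => norm_lineDeriv_le_of_lipschitz ℝ hf)
  rw [integral_congr_ae hae, setIntegral_triangle h, integral_const_mul,
    integral_add (hbd A CA u hA) (hbd B CB v hB), integral_refTri_lineDeriv hA,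
    integral_refTri_swap]
  have hsw : (∫ z in refTri, lineDeriv ℝ B (a + (z.swap).1 • u + (z.swap).2 • v) v) =
      ∫ z in refTri, lineDeriv ℝ B (a + z.1 • v + z.2 • u) v := by
    congr 1; ext z; congr 1; simp only [Prod.fst_swap, Prod.snd_swap]; module
  have hrefl : (∫ t in (0 : ℝ)..1, (B (a + (1 - t) • v + t • u) - B (a + t • u))) =
      ∫ t in (0 : ℝ)..1, (B (a + t • v + (1 - t) • u) - B (a + (1 - t) • u)) := by
    have := intervalIntegral.integral_comp_sub_left (a := 0) (b := 1) (fun t : ℝ =>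
      (B (a + t • v + (1 - t) • u) - B (a + (1 - t) • u))) 1
    simp only [sub_zero, sub_self] at this
    rw [← this]
    congr 1; ext t
    simp only [sub_sub_cancel]
  rw [hsw, integral_refTri_lineDeriv hB, hrefl, segFlux_swap a c, ← mul_assoc, div_eq_mul_inv]
  congr 1
  have hint : ∀ p q, IntervalIntegrable (fun r : ℝ =>
      φ (p + r • (q - p)) 0 * (q - p) 1 - φ (p + r • (q - p)) 1 * (q - p) 0) volume 0 1 := by
    intro p q
    have hl : Continuous fun r : ℝ => p + r • (q - p) := by fun_prop
    exact (((hl0.continuous.comp hl).mul continuous_const).sub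
      ((hl1.continuous.comp hl).mul continuous_const)).intervalIntegrable _ _
  have hcA := hA.continuous
  have hcB := hB.continuous
  rw [segFlux_swap b a, segFlux, segFlux, segFlux, ← hv,
    ← intervalIntegral.integral_neg, ← intervalIntegral.integral_neg,
    ← intervalIntegral.integral_add, ← intervalIntegral.integral_add,
    ← intervalIntegral.integral_add]
  -- On the side `bc` the sum `A + B` is the flux density from `b` to `c`; the boundary terms of `A`
  -- on `ac` and of `B` on `ab` give the other two fluxes.
  · congr 1; ext t
    have e1 : a + (1 - t) • u + t • v = b + t • (c - b) := by rw [hu, hv]; module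
    have e2 : a + t • v + (1 - t) • u = b + t • (c - b) := by rw [hu, hv]; module
    have e3 : a + (1 - t) • u = b + t • (a - b) := by rw [hu]; module
    rw [e1, e2, e3]
    simp only [hAdef, hBdef, hu, hv, PiLp.sub_apply]
    ring
  · exact (hint _ _).neg.add (hint _ _)
  · exact (hint _ _).neg
  · exact (hint _ _).neg
  · exact hint _ _
  · exact Continuous.intervalIntegrable (by fun_prop) _ _
  · exact Continuous.intervalIntegrable (by fun_prop) _ _

/-! ## Inequalities for Lipschitz functions and fields -/

lemma sq_integral_mul_le {α : Type*} [MeasurableSpace α] {μ : Measure α} {f g : α → ℝ}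
    (hf : MemLp f 2 μ) (hg : MemLp g 2 μ) :
    (∫ x, f x * g x ∂μ) ^ 2 ≤ (∫ x, f x ^ 2 ∂μ) * ∫ x, g x ^ 2 ∂μ := by
  have hfg : Integrable (fun x => f x * g x) μ := hf.integrable_mul hg
  have hf2 := hf.integrable_sq
  have hg2 := hg.integrable_sq
  have key : ∀ t : ℝ, 0 ≤ (∫ x, g x ^ 2 ∂μ) * (t * t) + (2 * ∫ x, f x * g x ∂μ) * t
      + ∫ x, f x ^ 2 ∂μ := by
    intro t
    have h0 : 0 ≤ ∫ x, (f x + t * g x) ^ 2 ∂μ := integral_nonneg fun x => sq_nonneg _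
    have e : (fun x => (f x + t * g x) ^ 2) =
        fun x => ((t * t) * g x ^ 2 + (2 * t) * (f x * g x)) + f x ^ 2 := by
      ext x; ring
    have hi : Integrable (fun x => (t * t) * g x ^ 2 + (2 * t) * (f x * g x)) μ :=
      (hg2.const_mul _).add (hfg.const_mul _)
    rw [e, integral_add hi hf2, integral_add (hg2.const_mul _) (hfg.const_mul _), integral_const_mul,
      integral_const_mul] at h0
    linarith
  have := discrim_le_zero key
  rw [discrim] at this
  nlinarith

lemma sq_setIntegral_le {α : Type*} [MeasurableSpace α] {μ : Measure α} [IsFiniteMeasure μ]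
    {f : α → ℝ} (hf : MemLp f 2 μ) :
    (∫ x, f x ∂μ) ^ 2 ≤ μ.real Set.univ * ∫ x, f x ^ 2 ∂μ := by
  have := sq_integral_mul_le (memLp_const (1 : ℝ)) hf
  simpa using this

/-- A real function that is Lipschitz on each of finitely many closed sets covering a normed space
is Lipschitz. -/
lemma exists_lipschitzWith_of_closed_cover {E ι : Type*} [NormedAddCommGroup E] [NormedSpace ℝ E]
    {f : E → ℝ} (I : Finset ι) (A : ι → Set E) (hA : ∀ i ∈ I, IsClosed (A i))
    (hcov : ∀ x, ∃ i ∈ I, x ∈ A i) (hlip : ∀ i ∈ I, ∃ C, LipschitzOnWith C f (A i)) :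
    ∃ C, LipschitzWith C f := by
  choose! c hc using hlip
  set C : NNReal := I.sup c with hC
  -- A neighborhood of `x` avoids the finitely many closed sets that do not contain `x`, so a nearby
  -- `y` shares with `x` whichever set covers `y`.
  have hloc : ∀ x, ∀ᶠ y in nhds x, |f y - f x| ≤ C * ‖y - x‖ := by
    intro x
    have h1 : ∀ᶠ y in nhds x, ∀ i ∈ I, y ∈ A i → x ∈ A i := by
      rw [Filter.eventually_all_finset]
      intro i hi
      by_cases hx : x ∈ A i
      · exact Filter.Eventually.of_forall fun _ _ => hx
      · filter_upwards [(hA i hi).isOpen_compl.mem_nhds hx] with y hy h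
        exact absurd h hy
    filter_upwards [h1] with y hy
    obtain ⟨i, hi, hyi⟩ := hcov y
    have h2 := (hc i hi).dist_le_mul y hyi x (hy i hi hyi)
    rw [Real.dist_eq, dist_eq_norm] at h2
    refine h2.trans ?_
    have : c i ≤ C := Finset.le_sup hi
    gcongr
  have hcont : Continuous f := by
    rw [continuous_iff_continuousAt]
    intro x
    rw [ContinuousAt, tendsto_iff_norm_sub_tendsto_zero]
    have h0 : Filter.Tendsto (fun y => (C : ℝ) * ‖y - x‖) (nhds x) (nhds 0) := by
      have : Continuous fun y => (C : ℝ) * ‖y - x‖ := by fun_prop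
      simpa using this.tendsto x
    exact squeeze_zero' (Filter.Eventually.of_forall fun _ => norm_nonneg _) (hloc x) h0
  -- The local bound has `x` fixed, so it controls the right slopes along the segment; a mean value
  -- inequality for continuous functions makes it global.
  have hone : ∀ x y, f y - f x ≤ C * ‖y - x‖ := by
    intro x y
    have hl : Continuous fun t : ℝ => x + t • (y - x) := by fun_prop
    have := image_le_of_liminf_slope_right_le_deriv_boundary (a := 0) (b := 1)
      (f := fun t : ℝ => f (x + t • (y - x))) (B := fun t => f x + t * (C * ‖y - x‖))
      (B' := fun _ => C * ‖y - x‖) (hcont.comp hl).continuousOn (by simp) (by fun_prop)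
      (fun t _ => by
        simpa using (((hasDerivAt_id t).mul_const (C * ‖y - x‖)).const_add (f x)).hasDerivWithinAt)
      (fun t _ r hr => by
        apply Filter.Eventually.frequently
        have h1 := nhdsWithin_le_nhds (s := Set.Ioi t)
          (hl.continuousAt.eventually (hloc (x + t • (y - x))))
        filter_upwards [h1, self_mem_nhdsWithin] with z hz hzt
        have hzt : t < z := hzt
        refine lt_of_le_of_lt ?_ hr
        rw [slope_def_field, div_le_iff₀ (by linarith)]
        refine (le_abs_self _).trans (hz.trans_eq ?_)
        have : x + z • (y - x) - (x + t • (y - x)) = (z - t) • (y - x) := by module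
        rw [this, norm_smul, Real.norm_eq_abs, abs_of_pos (by linarith)]
        ring)
    have h1 := this (Set.right_mem_Icc.2 zero_le_one)
    simp at h1
    linarith
  refine ⟨C, LipschitzWith.of_dist_le_mul fun x y => ?_⟩
  rw [Real.dist_eq, dist_eq_norm, abs_le]
  have := hone x y
  have h2 := hone y x
  rw [norm_sub_rev] at this
  constructor <;> linarith

lemma LipschitzWith.exists_sq {E : Type*} [PseudoMetricSpace E] {f : E → ℝ} {C : NNReal}
    (hf : LipschitzWith C f) {M : ℝ} (hM : ∀ x, |f x| ≤ M) :
    ∃ C', LipschitzWith C' fun x => f x ^ 2 := by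
  refine ⟨2 * M.toNNReal * C, LipschitzWith.of_dist_le_mul fun x y => ?_⟩
  have h := hf.dist_le_mul x y
  rw [Real.dist_eq] at h ⊢
  have hM0 : 0 ≤ M := (abs_nonneg _).trans (hM x)
  have h1 : |f x + f y| ≤ 2 * M := (abs_add_le _ _).trans (by linarith [hM x, hM y])
  have h2 : f x ^ 2 - f y ^ 2 = (f x + f y) * (f x - f y) := by ring
  rw [h2, abs_mul]
  push_cast
  rw [Real.coe_toNNReal _ hM0, mul_assoc]
  gcongr

/-! ### Partial derivatives of Lipschitz functions -/

lemma abs_partialD_le {f : Plane → ℝ} {C : NNReal} (hf : LipschitzWith C f) (b : Fin 2)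
    (x : Plane) : |partialD f b x| ≤ C := by
  have h1 := (fderiv ℝ f x).le_opNorm (EuclideanSpace.single b 1)
  have h2 := norm_fderiv_le_of_lipschitz ℝ hf (x₀ := x)
  simp only [PiLp.norm_single, norm_one, mul_one] at h1
  exact h1.trans h2

lemma measurable_partialD (f : Plane → ℝ) (b : Fin 2) : Measurable (partialD f b) :=
  measurable_fderiv_apply_const ℝ f _

lemma partialD_eq_zero_of_eventuallyEq {f : Plane → ℝ} {x : Plane}
    (h : f =ᶠ[nhds x] fun _ => 0) (b : Fin 2) : partialD f b x = 0 := by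
  rw [partialD, h.fderiv_eq]; simp

lemma partialD_eq_zero_of_notMem_tsupport {f : Plane → ℝ} {x : Plane} (h : x ∉ tsupport f)
    (b : Fin 2) : partialD f b x = 0 := by
  rw [partialD, fderiv_of_notMem_tsupport ℝ h]; simp

lemma memLp_partialD {f : Plane → ℝ} {C : NNReal} (hf : LipschitzWith C f) (b : Fin 2)
    (μ : Measure Plane) [IsFiniteMeasure μ] (p : ENNReal) : MemLp (partialD f b) p μ :=
  MemLp.of_bound (measurable_partialD f b).aestronglyMeasurable C
    (Filter.Eventually.of_forall (abs_partialD_le hf b))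

/-- The Poincaré inequality in a strip of width two. -/
lemma integral_sq_le_integral_partialD_sq {f : Plane → ℝ} {C : NNReal} (hf : LipschitzWith C f)
    (hs : HasCompactSupport f) {c : ℝ} (hc : ∀ x, f x ≠ 0 → |x 0 - c| ≤ 1) :
    ∫ x, f x ^ 2 ≤ 4 * ∫ x, partialD f 0 x ^ 2 := by
  obtain ⟨M, hM⟩ := hs.exists_bound_of_continuous hf.continuous
  obtain ⟨C', hC'⟩ := LipschitzWith.exists_sq hf hM
  have hs2 : HasCompactSupport fun x => f x ^ 2 := hs.comp_left (g := fun y : ℝ => y ^ 2) (by simp)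
  have hx0 : LipschitzWith 1 fun x : Plane => x 0 - c := by
    refine LipschitzWith.of_dist_le_mul fun x y => ?_
    rw [Real.dist_eq, NNReal.coe_one, one_mul, EuclideanSpace.dist_eq]
    apply Real.le_sqrt_of_sq_le
    simp only [Fin.sum_univ_two, Real.dist_eq, sq_abs]
    nlinarith [sq_nonneg (x 1 - y 1)]
  set e0 : Plane := EuclideanSpace.single 0 1 with he0
  -- Integration by parts with `x 0 - c`, whose derivative in the direction `e0` is one: `∫ f² = -∫
  -- (x₀ - c) ∂₀(f²)`.
  have hibp := LipschitzWith.integral_lineDeriv_mul_eq (μ := volume) hx0 hC' hs2 e0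
  have hl : ∀ x, lineDeriv ℝ (fun x : Plane => x 0 - c) x e0 = 1 := by
    intro x
    have : HasFDerivAt (fun x : Plane => x 0 - c) (EuclideanSpace.proj (0 : Fin 2) : Plane →L[ℝ] ℝ) x :=
      (EuclideanSpace.proj (0 : Fin 2) : Plane →L[ℝ] ℝ).hasFDerivAt.sub_const c
    rw [(this.hasLineDerivAt e0).lineDeriv]
    simp [he0]
  simp only [hl, one_mul] at hibp
  -- Young's inequality with `|x 0 - c| ≤ 1` where `f ≠ 0`. Absorbing `½ ∫ f²` on the left turns the
  -- constant `2` into `4`.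
  have hae : ∀ᵐ x : Plane, |lineDeriv ℝ (fun x => f x ^ 2) x (-e0) * (x 0 - c)| ≤
      1 / 2 * f x ^ 2 + 2 * partialD f 0 x ^ 2 := by
    filter_upwards [hf.ae_differentiableAt] with x hx
    have hd : HasFDerivAt (fun x => f x ^ 2) ((2 * f x) • fderiv ℝ f x) x := by
      have := hx.hasFDerivAt.pow 2
      simpa using this
    rw [(hd.hasLineDerivAt (-e0)).lineDeriv]
    have : ((2 * f x) • fderiv ℝ f x) (-e0) = - (2 * f x * partialD f 0 x) := by
      simp [partialD, he0]
    rw [this]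
    by_cases h0 : f x = 0
    · rw [h0]; simp; positivity
    · have h1 := abs_le.1 (hc x h0)
      have h2 : (x 0 - c) ^ 2 ≤ 1 := by rw [sq_le_one_iff_abs_le_one]; exact hc x h0
      have h3 := mul_le_mul_of_nonneg_left h2 (sq_nonneg (partialD f 0 x))
      rw [abs_le]
      constructor
      · nlinarith [sq_nonneg (f x - 2 * partialD f 0 x * (x 0 - c))]
      · nlinarith [sq_nonneg (f x + 2 * partialD f 0 x * (x 0 - c))]
  have hf2 : Integrable fun x => f x ^ 2 :=
    hC'.continuous.integrable_of_hasCompactSupport hs2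
  have hp2 : Integrable fun x => partialD f 0 x ^ 2 := by
    have h1 : IntegrableOn (fun x => partialD f 0 x ^ 2) (tsupport f) := by
      have := isFiniteMeasure_restrict.2 (hs.measure_lt_top (μ := volume)).ne
      exact (memLp_partialD hf 0 _ 2).integrable_sq
    refine (integrableOn_iff_integrable_of_support_subset fun x hx => ?_).1 h1
    by_contra hne
    exact hx (by simp [partialD_eq_zero_of_notMem_tsupport hne])
  have hle : ∫ x, f x ^ 2 ≤ ∫ x, (1 / 2 * f x ^ 2 + 2 * partialD f 0 x ^ 2) := by
    rw [hibp]
    refine integral_mono_ae ?_ ((hf2.const_mul _).add (hp2.const_mul _))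
      (hae.mono fun x hx => (le_abs_self _).trans hx)
    exact ((hf2.const_mul _).add (hp2.const_mul _)).mono'
      ((measurable_lineDeriv hC'.continuous).mul (by fun_prop)).aestronglyMeasurable hae
  rw [integral_add (hf2.const_mul _) (hp2.const_mul _), integral_const_mul,
    integral_const_mul] at hle
  linarith

/-! ## Jets with square integrable entries -/

/-- The pointwise density of the squared `H¹` norm. -/
def sqJ (J : Jet) (x : Plane) : ℝ := (∑ a, J.1 x a ^ 2) + ∑ a, ∑ b, J.2 x a b ^ 2

lemma sqJ_nonneg (J : Jet) (x : Plane) : 0 ≤ sqJ J x := by unfold sqJ; positivity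

lemma sqJ_add_le (J J' : Jet) (x : Plane) : sqJ (J + J') x ≤ 2 * sqJ J x + 2 * sqJ J' x := by
  have key : ∀ s t : ℝ, (s + t) ^ 2 ≤ 2 * s ^ 2 + 2 * t ^ 2 := fun s t => by
    nlinarith [sq_nonneg (s - t)]
  simp only [sqJ, Prod.fst_add, Prod.snd_add, Pi.add_apply, Fin.sum_univ_two]
  linarith [key (J.1 x 0) (J'.1 x 0), key (J.1 x 1) (J'.1 x 1), key (J.2 x 0 0) (J'.2 x 0 0),
    key (J.2 x 0 1) (J'.2 x 0 1), key (J.2 x 1 0) (J'.2 x 1 0), key (J.2 x 1 1) (J'.2 x 1 1)]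

lemma divJ_sq_le (J : Jet) (x : Plane) : divJ J x ^ 2 ≤ 2 * sqJ J x := by
  simp only [sqJ, divJ, Fin.sum_univ_two]
  nlinarith [sq_nonneg (J.2 x 0 0 - J.2 x 1 1), sq_nonneg (J.2 x 0 1), sq_nonneg (J.2 x 1 0),
    sq_nonneg (J.1 x 0), sq_nonneg (J.1 x 1)]

section

variable {U : Set Plane} {J J' : Jet}

lemma JetL2.add (h : JetL2 U J) (h' : JetL2 U J') : JetL2 U (J + J') :=
  ⟨fun a => (h.1 a).add (h'.1 a), fun a b => (h.2 a b).add (h'.2 a b)⟩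

lemma JetL2.sub (h : JetL2 U J) (h' : JetL2 U J') : JetL2 U (J - J') :=
  ⟨fun a => (h.1 a).sub (h'.1 a), fun a b => (h.2 a b).sub (h'.2 a b)⟩

lemma JetL2.const_smul (c : ℝ) (h : JetL2 U J) : JetL2 U (c • J) :=
  ⟨fun a => (h.1 a).const_smul c, fun a b => (h.2 a b).const_smul c⟩

lemma JetL2.zero : JetL2 U 0 := ⟨fun _ => MemLp.zero, fun _ _ => MemLp.zero⟩

lemma JetL2.sum {ι : Type*} {s : Finset ι} {J : ι → Jet} (h : ∀ i ∈ s, JetL2 U (J i)) :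
    JetL2 U (∑ i ∈ s, J i) :=
  Finset.sum_induction J (JetL2 U) (fun _ _ h h' => h.add h') JetL2.zero h

lemma JetL2.mono_set {V : Set Plane} (h : JetL2 U J) (hV : V ⊆ U) : JetL2 V J :=
  ⟨fun a => (h.1 a).mono_measure (Measure.restrict_mono_set _ hV),
    fun a b => (h.2 a b).mono_measure (Measure.restrict_mono_set _ hV)⟩

lemma JetL2.congr (h : JetL2 U J) (h1 : ∀ᵐ x ∂volume.restrict U, J.1 x = J'.1 x ∧ J.2 x = J'.2 x) :
    JetL2 U J' := by
  refine ⟨fun a => (memLp_congr_ae ?_).1 (h.1 a), fun a b => (memLp_congr_ae ?_).1 (h.2 a b)⟩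
  · filter_upwards [h1] with x hx using by rw [hx.1]
  · filter_upwards [h1] with x hx using by rw [hx.2]

lemma JetL2.memLp_divJ (h : JetL2 U J) : MemLp (divJ J) 2 (volume.restrict U) := by
  have := (h.2 0 0).add (h.2 1 1)
  refine this.congr_norm ?_ ?_
  · convert this.aestronglyMeasurable using 1
    ext x; simp [divJ]
  · exact Filter.Eventually.of_forall fun x => by simp [divJ]

lemma JetL2.integrable_val (h : JetL2 U J) :
    IntegrableOn (fun x => ∑ a, J.1 x a ^ 2) U :=
  integrable_finsetSum _ fun a _ => (h.1 a).integrable_sq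

lemma JetL2.integrable_grad (h : JetL2 U J) :
    IntegrableOn (fun x => ∑ a, ∑ b, J.2 x a b ^ 2) U :=
  integrable_finsetSum _ fun a _ => integrable_finsetSum _ fun b _ => (h.2 a b).integrable_sq

lemma JetL2.integrable_sqJ (h : JetL2 U J) : IntegrableOn (sqJ J) U :=
  h.integrable_val.add h.integrable_grad

lemma JetL2.integral_sqJ (h : JetL2 U J) :
    ∫ x in U, sqJ J x = (∫ x in U, ∑ a, J.1 x a ^ 2) + energy U J :=
  integral_add h.integrable_val h.integrable_grad

lemma h1norm_nonneg (U : Set Plane) (J : Jet) : 0 ≤ h1norm U J := Real.sqrt_nonneg _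

lemma JetL2.h1norm_sq (h : JetL2 U J) : h1norm U J ^ 2 = ∫ x in U, sqJ J x := by
  rw [h.integral_sqJ, h1norm, Real.sq_sqrt]
  have h1 : 0 ≤ ∫ x in U, ∑ a, J.1 x a ^ 2 := integral_nonneg fun x => by positivity
  have h2 : 0 ≤ energy U J := integral_nonneg fun x => by positivity
  exact add_nonneg h1 h2

lemma l2norm_sq (U : Set Plane) (p : Plane → ℝ) : l2norm U p ^ 2 = ∫ x in U, p x ^ 2 :=
  Real.sq_sqrt (integral_nonneg fun _ => sq_nonneg _)

lemma l2norm_nonneg (U : Set Plane) (p : Plane → ℝ) : 0 ≤ l2norm U p := Real.sqrt_nonneg _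

lemma JetL2.integrable_divJ_mul {p : Plane → ℝ} (h : JetL2 U J)
    (hp : MemLp p 2 (volume.restrict U)) : IntegrableOn (fun x => divJ J x * p x) U :=
  h.memLp_divJ.integrable_mul hp

lemma JetL2.sq_integral_divJ_mul_le {p : Plane → ℝ} (h : JetL2 U J)
    (hp : MemLp p 2 (volume.restrict U)) :
    (∫ x in U, divJ J x * p x) ^ 2 ≤ 2 * h1norm U J ^ 2 * l2norm U p ^ 2 := by
  refine (sq_integral_mul_le h.memLp_divJ hp).trans ?_
  rw [l2norm_sq, h.h1norm_sq]
  refine mul_le_mul_of_nonneg_right ?_ (integral_nonneg fun x => sq_nonneg _)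
  rw [← integral_const_mul]
  exact integral_mono h.memLp_divJ.integrable_sq (h.integrable_sqJ.const_mul 2) (divJ_sq_le J)

lemma JetL2.h1norm_add_sq_le (h : JetL2 U J) (h' : JetL2 U J') :
    h1norm U (J + J') ^ 2 ≤ 2 * h1norm U J ^ 2 + 2 * h1norm U J' ^ 2 := by
  rw [(h.add h').h1norm_sq, h.h1norm_sq, h'.h1norm_sq, ← integral_const_mul, ← integral_const_mul,
    ← integral_add (h.integrable_sqJ.const_mul 2) (h'.integrable_sqJ.const_mul 2)]
  exact integral_mono (h.add h').integrable_sqJ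
    ((h.integrable_sqJ.const_mul 2).add (h'.integrable_sqJ.const_mul 2)) (sqJ_add_le J J')

lemma divJ_sub (J J' : Jet) (x : Plane) : divJ (J - J') x = divJ J x - divJ J' x := by
  simp [divJ]

lemma divJ_sum_smul {ι : Type*} (s : Finset ι) (c : ι → ℝ) (J : ι → Jet) (x : Plane) :
    divJ (∑ i ∈ s, c i • J i) x = ∑ i ∈ s, c i * divJ (J i) x := by
  simp [divJ, Fin.sum_univ_two, Prod.snd_sum, Finset.sum_apply, Finset.sum_add_distrib, mul_add]

end

/-! ## Lipschitz fields and test fields -/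

lemma jetL2_jet_of_lipschitz {φ : VField} {C : NNReal} (hφ : LipschitzWith C φ) {U : Set Plane}
    (hU : Bornology.IsBounded U) : JetL2 U (jet φ) := by
  have hfin : IsFiniteMeasure (volume.restrict U) :=
    isFiniteMeasure_restrict.2 hU.measure_lt_top.ne
  refine ⟨fun a => ?_, fun a b => memLp_partialD (LipschitzWith.component hφ a) b _ 2⟩
  have hc := (LipschitzWith.component hφ a).continuous
  obtain ⟨M, hM⟩ := (Metric.isCompact_of_isClosed_isBounded isClosed_closure
    hU.closure).exists_bound_of_continuousOn hc.continuousOn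
  have hb : ∀ᵐ x ∂volume.restrict (closure U), ‖φ x a‖ ≤ M := by
    filter_upwards [ae_restrict_mem isClosed_closure.measurableSet] with x hx using hM x hx
  exact MemLp.of_bound hc.measurable.aestronglyMeasurable M
    (ae_restrict_of_ae_restrict_of_subset subset_closure hb)

lemma IsTest.exists_lipschitzWith {U : Set Plane} {φ : VField} (h : IsTest U φ) :
    ∃ C, LipschitzWith C φ :=
  h.1.lipschitzWith_of_hasCompactSupport h.2.1 (by simp)

lemma hasCompactSupport_component {φ : VField} (h : HasCompactSupport φ) (a : Fin 2) :
    HasCompactSupport fun x => φ x a :=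
  h.comp_left (g := fun v : Fin 2 → ℝ => v a) rfl

lemma jet_eq_zero_of_notMem_tsupport {φ : VField} {x : Plane} (h : x ∉ tsupport φ) :
    (jet φ).1 x = 0 ∧ (jet φ).2 x = 0 := by
  have h0 := notMem_tsupport_iff_eventuallyEq.1 h
  refine ⟨h0.self_of_nhds, ?_⟩
  ext a b
  refine partialD_eq_zero_of_eventuallyEq ?_ b
  filter_upwards [h0] with y hy
  rw [hy]; rfl

/-- Integration by parts against the constant function one. -/
lemma integral_divJ_jet_eq_zero {φ : VField} {C : NNReal} (hφ : LipschitzWith C φ)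
    (hs : HasCompactSupport φ) : ∫ x, divJ (jet φ) x = 0 := by
  have key : ∀ a, Integrable (partialD (fun y => φ y a) a) ∧
      ∫ x, partialD (fun y => φ y a) a x = 0 := by
    intro a
    have hl := LipschitzWith.component hφ a
    have hsa := hasCompactSupport_component hs a
    constructor
    · have h1 : IntegrableOn (partialD (fun y => φ y a) a) (tsupport fun y => φ y a) := by
        have := isFiniteMeasure_restrict.2 (hsa.measure_lt_top (μ := volume)).ne
        exact (memLp_partialD hl a _ 1).integrable le_rfl
      refine (integrableOn_iff_integrable_of_support_subset fun x hx => ?_).1 h1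
      by_contra hne
      exact hx (partialD_eq_zero_of_notMem_tsupport hne a)
    · have h1 := LipschitzWith.integral_lineDeriv_mul_eq (μ := (volume : Measure Plane))
        (LipschitzWith.const (1 : ℝ)) hl hsa (-EuclideanSpace.single a 1)
      have h0 : ∀ x v : Plane, lineDeriv ℝ (fun _ : Plane => (1 : ℝ)) x v = 0 := by
        intro x v; simp [lineDeriv]
      simp only [h0, zero_mul, integral_zero, neg_neg, mul_one] at h1
      rw [h1]
      apply integral_congr_ae
      filter_upwards [hl.ae_differentiableAt] with x hx
      rw [hx.lineDeriv_eq_fderiv]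
      rfl
  simp only [divJ_jet]
  rw [integral_add (key 0).1 (key 1).1, (key 0).2, (key 1).2, add_zero]

lemma IsTest.setIntegral_divJ_eq_zero {U : Set Plane} {φ : VField} (h : IsTest U φ) :
    ∫ x in U, divJ (jet φ) x = 0 := by
  obtain ⟨C, hC⟩ := h.exists_lipschitzWith
  rw [setIntegral_eq_integral_of_forall_compl_eq_zero, integral_divJ_jet_eq_zero hC h.2.1]
  intro x hx
  have := (jet_eq_zero_of_notMem_tsupport fun hx' => hx (h.2.2 hx')).2
  simp [divJ, this]

/-- The pairing is continuous in the `H¹` norm by Cauchy–Schwarz and `|div|² ≤ 2|∇|²`. -/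
lemma tendsto_integral_divJ_mul {U : Set Plane} (hU : Bornology.IsBounded U) {J : Jet}
    (hJ : JetL2 U J) {φ : ℕ → VField} (hφ : ∀ n, IsTest U (φ n))
    (hlim : Filter.Tendsto (fun n => h1norm U (J - jet (φ n))) Filter.atTop (nhds 0))
    {p : Plane → ℝ} (hp : MemLp p 2 (volume.restrict U)) :
    Filter.Tendsto (fun n => ∫ x in U, divJ (jet (φ n)) x * p x) Filter.atTop
      (nhds (∫ x in U, divJ J x * p x)) := by
  have hL : ∀ n, JetL2 U (jet (φ n)) := fun n => by
    obtain ⟨C, hC⟩ := (hφ n).exists_lipschitzWith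
    exact jetL2_jet_of_lipschitz hC hU
  rw [tendsto_iff_norm_sub_tendsto_zero]
  have hb : ∀ n, ‖(∫ x in U, divJ (jet (φ n)) x * p x) - ∫ x in U, divJ J x * p x‖ ≤
      2 * h1norm U (J - jet (φ n)) * l2norm U p := by
    intro n
    rw [norm_sub_rev, ← integral_sub (hJ.integrable_divJ_mul hp) ((hL n).integrable_divJ_mul hp)]
    have h1 := (hJ.sub (hL n)).sq_integral_divJ_mul_le hp
    simp only [divJ_sub, sub_mul] at h1
    have h0 : 0 ≤ h1norm U (J - jet (φ n)) * l2norm U p :=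
      mul_nonneg (h1norm_nonneg _ _) (l2norm_nonneg _ _)
    refine abs_le_of_sq_le_sq (h1.trans ?_) (by linarith)
    nlinarith
  refine squeeze_zero (fun n => norm_nonneg _) hb ?_
  simpa using (hlim.const_mul 2).mul_const (l2norm U p)

/-- The mean divergence vanishes for test fields and passes to the limit. Consequently the mean
divergence of an extension depends on its boundary data only. -/
lemma setIntegral_divJ_eq_zero_of_mem_H10 {U : Set Plane} (hU : Bornology.IsBounded U) {J : Jet}
    (hJ : J ∈ H10 U) : ∫ x in U, divJ J x = 0 := by
  obtain ⟨hL, φ, hφ, hlim⟩ := hJ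
  have hfin : IsFiniteMeasure (volume.restrict U) :=
    isFiniteMeasure_restrict.2 hU.measure_lt_top.ne
  have := tendsto_integral_divJ_mul hU hL hφ hlim (memLp_const (1 : ℝ))
  simp only [mul_one, (hφ _).setIntegral_divJ_eq_zero] at this
  exact (tendsto_nhds_unique this tendsto_const_nhds)

/-- A quotient in the inf-sup condition is attained by a test field up to a factor four. -/
lemma exists_isTest_of_lt_quotient {U : Set Plane} (hU : Bornology.IsBounded U) {J : Jet}
    (hJ : J ∈ H10 U) {p : Plane → ℝ} (hp : MemLp p 2 (volume.restrict U)) {c : ℝ} (hc : 0 ≤ c)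
    (hlt : c < (∫ x in U, divJ J x * p x) / h1norm U J) :
    ∃ φ, IsTest U φ ∧ 0 < ∫ x in U, divJ (jet φ) x * p x ∧
      c / 4 * h1norm U (jet φ) ≤ ∫ x in U, divJ (jet φ) x * p x := by
  obtain ⟨hL, φ, hφ, hlim⟩ := hJ
  have hn : 0 < h1norm U J := by
    refine (h1norm_nonneg _ _).lt_of_ne fun h0 => ?_
    rw [← h0, div_zero] at hlt
    exact absurd hlt (not_lt.2 hc)
  have hlt' := (lt_div_iff₀ hn).1 hlt
  have hI : 0 < ∫ x in U, divJ J x * p x := lt_of_le_of_lt (by positivity) hlt'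
  -- For large `n` the numerator is at least half of its limit, and the `H¹` distance to `J` is less
  -- than the norm of `J`, so the denominator is at most doubled. Together these lose the factor
  -- four.
  have e1 := (tendsto_integral_divJ_mul hU hL hφ hlim hp).eventually
    (lt_mem_nhds (half_lt_self hI))
  have e2 := hlim.eventually (gt_mem_nhds hn)
  obtain ⟨n, h1, h2⟩ := (e1.and e2).exists
  refine ⟨φ n, hφ n, (half_pos hI).trans h1, ?_⟩
  have hLn : JetL2 U (jet (φ n)) := by
    obtain ⟨C, hC⟩ := (hφ n).exists_lipschitzWith
    exact jetL2_jet_of_lipschitz hC hU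
  have h3 : h1norm U (jet (φ n)) ≤ 2 * h1norm U J := by
    have hneg : jet (φ n) = J + (-1 : ℝ) • (J - jet (φ n)) := by module
    have h4 := hL.h1norm_add_sq_le ((hL.sub hLn).const_smul (-1))
    rw [← hneg] at h4
    have h5 : h1norm U ((-1 : ℝ) • (J - jet (φ n))) = h1norm U (J - jet (φ n)) := by
      simp only [h1norm, energy, neg_smul, one_smul, Prod.fst_neg, Prod.snd_neg, Pi.neg_apply,
        neg_sq]
    rw [h5] at h4
    have h6 := h1norm_nonneg U (J - jet (φ n))
    refine abs_le_of_sq_le_sq' (by nlinarith) (by linarith) |>.2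
  nlinarith

/-! ## The flux through an edge of a triangle -/

lemma integral_refTri_one : ∫ _ in refTri, (1 : ℝ) = 1 / 2 := by
  rw [integral_refTri (h := fun _ => 1) ⟨1, by simp⟩ measurable_const]
  simp only [intervalIntegral.integral_const, smul_eq_mul, mul_one, sub_zero]
  rw [intervalIntegral.integral_sub (by simp) (by simp)]
  simp
  norm_num

lemma volume_real_triangle {a b c : Plane} (h : cross (b - a) (c - a) ≠ 0) :
    volume.real (convexHull ℝ ({a, b, c} : Set Plane)) = |cross (b - a) (c - a)| / 2 := by
  have := setIntegral_triangle h fun _ => 1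
  rw [integral_refTri_one] at this
  simp at this
  rw [this]; rfl

lemma isCompact_triangle (a b c : Plane) : IsCompact (convexHull ℝ ({a, b, c} : Set Plane)) :=
  (Set.toFinite ({a, b, c} : Set Plane)).isCompact_convexHull ℝ

lemma sq_det_le (s t s' t' : ℝ) : (s * t - s' * t') ^ 2 ≤ (s ^ 2 + s' ^ 2) * (t' ^ 2 + t ^ 2) := by
  nlinarith [sq_nonneg (s * t' + s' * t)]

/-- The pointwise estimate for the divergence of `(φ × w)(x - a)`: `f` stands for the values of `φ`,
`p` for its gradient, `w` for the edge vector and `y` for `x - a`. It reads `(2g + y·∇g)² ≤ 8g² +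
2|∇g|²` with `g = φ × w`. -/
lemma sq_div_radial_le {f0 f1 w0 w1 p00 p01 p10 p11 y0 y1 d : ℝ} (hw : w0 ^ 2 + w1 ^ 2 ≤ d ^ 2)
    (hy : y0 ^ 2 + y1 ^ 2 ≤ 1) :
    ((f0 * w1 - f1 * w0) + y0 * (w1 * p00 - w0 * p10) +
      ((f0 * w1 - f1 * w0) + y1 * (w1 * p01 - w0 * p11))) ^ 2 ≤
      8 * d ^ 2 * (f0 ^ 2 + f1 ^ 2 + (p00 ^ 2 + p01 ^ 2 + (p10 ^ 2 + p11 ^ 2))) := by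
  have key : ∀ s s' : ℝ, (s * w1 - s' * w0) ^ 2 ≤ (s ^ 2 + s' ^ 2) * d ^ 2 := fun s s' =>
    (sq_det_le s w1 s' w0).trans (mul_le_mul_of_nonneg_left hw (by positivity))
  have b1 := key f0 f1
  have b2 := key p00 p10
  have b3 := key p01 p11
  rw [mul_comm w1 p00, mul_comm w0 p10, mul_comm w1 p01, mul_comm w0 p11]
  generalize f0 * w1 - f1 * w0 = g at *
  generalize p00 * w1 - p10 * w0 = G0 at *
  generalize p01 * w1 - p11 * w0 = G1 at *
  have b4 : (y0 * G0 + y1 * G1) ^ 2 ≤ G0 ^ 2 + G1 ^ 2 := by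
    have h1 := sq_det_le y0 G0 (-y1) G1
    have h2 := mul_le_mul_of_nonneg_right hy (add_nonneg (sq_nonneg G1) (sq_nonneg G0))
    rw [neg_mul, sub_neg_eq_add, neg_sq] at h1
    linarith
  have b5 : (g + y0 * G0 + (g + y1 * G1)) ^ 2 ≤ 8 * g ^ 2 + 2 * (y0 * G0 + y1 * G1) ^ 2 := by
    generalize y0 * G0 = A
    generalize y1 * G1 = B
    linarith [sq_nonneg (2 * g - (A + B)), show 8 * g ^ 2 + 2 * (A + B) ^ 2 - (g + A + (g + B)) ^ 2
      = (2 * g - (A + B)) ^ 2 by ring]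
  have b6 : 0 ≤ (p00 ^ 2 + p10 ^ 2) * d ^ 2 := by positivity
  have b7 : 0 ≤ (p01 ^ 2 + p11 ^ 2) * d ^ 2 := by positivity
  linarith

/-- The square of the flux through an edge of a triangle of diameter at most one is bounded by the
`H¹` norm on the triangle. -/
lemma segFlux_sq_le {φ : VField} (hφ : ContDiff ℝ 1 φ) (hs : HasCompactSupport φ) {a b c : Plane}
    (h : cross (b - a) (c - a) ≠ 0) {d σ : ℝ} (hd1 : d ≤ 1)
    (hd : ∀ x ∈ convexHull ℝ ({a, b, c} : Set Plane),
      ∀ y ∈ convexHull ℝ ({a, b, c} : Set Plane), dist x y ≤ d)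
    (hσ : d ^ 2 ≤ σ * volume.real (convexHull ℝ ({a, b, c} : Set Plane))) :
    segFlux b c φ ^ 2 ≤
      2 * σ * ∫ x in convexHull ℝ ({a, b, c} : Set Plane), sqJ (jet φ) x := by
  set T := convexHull ℝ ({a, b, c} : Set Plane) with hT
  have ha : a ∈ T := subset_convexHull ℝ _ (by simp)
  have hb : b ∈ T := subset_convexHull ℝ _ (by simp)
  have hcT : c ∈ T := subset_convexHull ℝ _ (by simp)
  have hTb : Bornology.IsBounded T := (isCompact_triangle a b c).isBounded
  set w := c - b with hw
  have hφa : ∀ i, ContDiff ℝ 1 fun x => φ x i := fun i => contDiff_pi.1 hφ i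
  set g : Plane → ℝ := fun x => φ x 0 * w 1 - φ x 1 * w 0 with hg
  have hgc : ContDiff ℝ 1 g := ((hφa 0).mul contDiff_const).sub ((hφa 1).mul contDiff_const)
  have hcoord : ∀ i : Fin 2, ContDiff ℝ 1 fun x : Plane => x i - a i := fun i =>
    (EuclideanSpace.proj i : Plane →L[ℝ] ℝ).contDiff.sub contDiff_const
  -- This field is parallel to the two sides through `a`, so it has no flux through them. On the
  -- opposite side `x - a` has constant normal component, and the flux of `X` is the doubled signed
  -- area times the flux of `φ`.
  set X : VField := fun x i => g x * (x i - a i) with hX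
  have hXc : ContDiff ℝ 1 X := contDiff_pi.2 fun i => hgc.mul (hcoord i)
  have hXs : HasCompactSupport X := by
    refine hs.mono fun x hx => ?_
    refine fun h0 => hx ?_
    ext i
    simp [hX, hg, h0]
  obtain ⟨CX, hCX⟩ := hXc.lipschitzWith_of_hasCompactSupport hXs one_ne_zero
  have hgauss := setIntegral_div_triangle hCX h
  have z1 : segFlux a b X = 0 := by
    unfold segFlux
    refine (intervalIntegral.integral_congr fun r _ => ?_).trans intervalIntegral.integral_zero
    simp [hX]; ring
  have z2 : segFlux c a X = 0 := by
    unfold segFlux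
    refine (intervalIntegral.integral_congr fun r _ => ?_).trans intervalIntegral.integral_zero
    simp [hX]; ring
  have z3 : segFlux b c X = cross (b - a) (c - a) * segFlux b c φ := by
    unfold segFlux
    rw [← intervalIntegral.integral_const_mul]
    congr 1; ext r
    simp [hX, hg, hw, cross]; ring
  have hflux : (∫ x in T, divJ (jet X) x) = |cross (b - a) (c - a)| * segFlux b c φ := by
    rw [hT, hgauss, z1, z2, z3, zero_add, add_zero, ← mul_assoc, div_mul_cancel₀ _ h]
  have hdiv : ∀ x ∈ T, divJ (jet X) x ^ 2 ≤ 8 * d ^ 2 * sqJ (jet φ) x := by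
    intro x hx
    have df : ∀ i, DifferentiableAt ℝ (fun y => φ y i) x := fun i =>
      (hφa i).differentiable one_ne_zero x
    have hgd : HasFDerivAt g (w 1 • fderiv ℝ (fun y => φ y 0) x -
        w 0 • fderiv ℝ (fun y => φ y 1) x) x :=
      ((df 0).hasFDerivAt.mul_const _).sub ((df 1).hasFDerivAt.mul_const _)
    have hpd : ∀ i, partialD (fun y => X y i) i x =
        g x + (x i - a i) * (w 1 * partialD (fun y => φ y 0) i x -
          w 0 * partialD (fun y => φ y 1) i x) := by
      intro i
      have h1 : HasFDerivAt (fun y : Plane => y i - a i)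
          (EuclideanSpace.proj i : Plane →L[ℝ] ℝ) x :=
        (EuclideanSpace.proj i : Plane →L[ℝ] ℝ).hasFDerivAt.sub_const _
      have h2 := hgd.mul h1
      rw [partialD, HasFDerivAt.fderiv (f := fun y => X y i) h2]
      simp [partialD]
    have hwd : w 0 ^ 2 + w 1 ^ 2 ≤ d ^ 2 := by
      have h1 := hd c hcT b hb
      have hd0 : 0 ≤ d := dist_nonneg.trans h1
      rw [EuclideanSpace.dist_eq, Real.sqrt_le_left hd0] at h1
      simpa [Fin.sum_univ_two, Real.dist_eq, sq_abs, hw] using h1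
    have hxd : (x 0 - a 0) ^ 2 + (x 1 - a 1) ^ 2 ≤ 1 := by
      have h1 := (hd x hx a ha).trans hd1
      rw [EuclideanSpace.dist_eq, Real.sqrt_le_left zero_le_one] at h1
      simpa [Fin.sum_univ_two, Real.dist_eq, sq_abs] using h1
    rw [divJ_jet, hpd, hpd]
    simp only [sqJ, jet, grad, Fin.sum_univ_two]
    exact sq_div_radial_le hwd hxd
  have hL := jetL2_jet_of_lipschitz hCX hTb
  obtain ⟨Cφ, hCφ⟩ := hφ.lipschitzWith_of_hasCompactSupport hs one_ne_zero
  have hLφ := jetL2_jet_of_lipschitz hCφ hTb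
  have hfin : IsFiniteMeasure (volume.restrict T) :=
    isFiniteMeasure_restrict.2 hTb.measure_lt_top.ne
  have hmono : ∫ x in T, divJ (jet X) x ^ 2 ≤ 8 * d ^ 2 * ∫ x in T, sqJ (jet φ) x := by
    rw [← integral_const_mul]
    exact setIntegral_mono_on hL.memLp_divJ.integrable_sq (hLφ.integrable_sqJ.const_mul _)
      (isCompact_triangle a b c).measurableSet hdiv
  have hcs := sq_setIntegral_le hL.memLp_divJ
  rw [hflux, measureReal_restrict_apply_univ] at hcs
  have hvol := volume_real_triangle h
  rw [← hT] at hvol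
  set m := volume.real T
  have hm : 0 < m := by rw [hvol]; have := abs_pos.2 h; linarith
  have hcr : |cross (b - a) (c - a)| = 2 * m := by linarith
  rw [hcr] at hcs
  set S := ∫ x in T, sqJ (jet φ) x
  have hS : 0 ≤ S := integral_nonneg fun x => sqJ_nonneg _ x
  -- With area `m`, Cauchy–Schwarz gives `4m² flux² ≤ m · 8d² S`. Shape regularity `d² ≤ σ m` then
  -- leaves `flux² ≤ 2σ S`.
  have h1 : (2 * m * segFlux b c φ) ^ 2 ≤ m * (8 * d ^ 2 * S) :=
    hcs.trans (mul_le_mul_of_nonneg_left hmono hm.le)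
  have h2 : d ^ 2 * S ≤ σ * m * S := mul_le_mul_of_nonneg_right hσ hS
  have h3 : m ^ 2 * segFlux b c φ ^ 2 ≤ m ^ 2 * (2 * σ * S) := by nlinarith
  exact le_of_mul_le_mul_left h3 (by positivity)

/-! ## Geometry of triangulations -/

lemma isCompact_hull (K : Finset Plane) : IsCompact (hull K) :=
  K.finite_toSet.isCompact_convexHull ℝ

lemma isClosed_hull (K : Finset Plane) : IsClosed (hull K) := (isCompact_hull K).isClosed

lemma volume_frontier_hull (K : Finset Plane) : volume (frontier (hull K)) = 0 :=
  (convex_convexHull ℝ _).addHaar_frontier volume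

lemma interior_hull_ae_eq (K : Finset Plane) : interior (hull K) =ᵐ[volume] hull K :=
  interior_ae_eq_of_null_frontier (volume_frontier_hull K)

open Classical in
lemma hull_triple (a b c : Plane) :
    hull {a, b, c} = convexHull ℝ ({a, b, c} : Set Plane) := by simp [hull]

open Classical in
lemma hull_pair (a b : Plane) : hull {a, b} = segment ℝ a b := by simp [hull, convexHull_pair]

lemma collinear_of_cross_eq_zero {p q r : Plane} (hpq : p ≠ q)
    (h : cross (q - p) (r - p) = 0) : Collinear ℝ ({p, q, r} : Set Plane) := by
  rw [collinear_iff_of_mem (p₀ := p) (by simp)]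
  set w := q - p with hw
  have hw2 : w 0 ^ 2 + w 1 ^ 2 ≠ 0 := by
    intro h0
    have h00 : w 0 = 0 := by nlinarith [sq_nonneg (w 0), sq_nonneg (w 1)]
    have h01 : w 1 = 0 := by nlinarith [sq_nonneg (w 0), sq_nonneg (w 1)]
    refine hpq ?_
    ext i
    have e0 : q 0 - p 0 = 0 := h00
    have e1 : q 1 - p 1 = 0 := h01
    fin_cases i
    · simp only [Fin.zero_eta]; linarith
    · simp only [Fin.mk_one]; linarith
  refine ⟨w, ?_⟩
  rintro x (rfl | rfl | rfl)
  · exact ⟨0, by simp⟩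
  · exact ⟨1, by simp [hw]⟩
  -- The coefficient of the orthogonal projection of `x - p` onto `w`.
  · refine ⟨(w 0 * (x - p) 0 + w 1 * (x - p) 1) / (w 0 ^ 2 + w 1 ^ 2), ?_⟩
    simp only [cross] at h
    have h' : w 0 * (x 1 - p 1) - w 1 * (x 0 - p 0) = 0 := h
    ext i
    simp only [vadd_eq_add, PiLp.add_apply, PiLp.smul_apply, smul_eq_mul, PiLp.sub_apply]
    rw [div_mul_eq_mul_div, eq_comm, div_add' _ _ _ hw2, div_eq_iff hw2]
    fin_cases i
    · simp only [Fin.zero_eta]; linear_combination (- w 1) * (- h')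
    · simp only [Fin.mk_one]; linear_combination (- w 0) * h'

namespace Triangulation

variable (T : Triangulation)

lemma mem_tri {K : Finset Plane} : K ∈ T.tri ↔ K ∈ T.faces ∧ K.card = 3 := by
  simp [tri]

variable {T}

open Classical in
lemma cross_ne_zero {p q r : Plane} (h : ({p, q, r} : Finset Plane) ∈ T.tri) :
    cross (q - p) (r - p) ≠ 0 := by
  obtain ⟨hf, hc⟩ := T.mem_tri.1 h
  obtain ⟨h1, h2, h3⟩ := Finset.card_triple_eq_three_iff.1 hc
  intro h0
  have hcol := collinear_of_cross_eq_zero h1 h0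
  have hind := T.indep hf
  let e : Fin 3 ↪ ({p, q, r} : Finset Plane) :=
    ⟨![⟨p, by simp⟩, ⟨q, by simp⟩, ⟨r, by simp⟩], by
      intro i j hij
      fin_cases i <;> fin_cases j <;> simp_all⟩
  have he : ![p, q, r] = Subtype.val ∘ e := by
    funext i
    fin_cases i <;> rfl
  have hi := hind.comp_embedding e
  rw [← he] at hi
  exact affineIndependent_iff_not_collinear_set.1 hi hcol

open Classical in
lemma exists_third_vertex {K s : Finset Plane} (hK : K ∈ T.tri) (hs : s ⊆ K) {p q : Plane}
    (hpq : s = {p, q}) (hs2 : s.card = 2) :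
    ∃ r, K = {p, q, r} ∧ cross (q - p) (r - p) ≠ 0 := by
  obtain ⟨hf, hc⟩ := T.mem_tri.1 hK
  have h1 : (K \ s).card = 1 := by rw [Finset.card_sdiff_of_subset hs, hc, hs2]
  obtain ⟨r, hr⟩ := Finset.card_eq_one.1 h1
  have : K = {p, q, r} := by
    rw [← Finset.union_sdiff_of_subset hs, hr, hpq]
    ext x; simp
  subst this
  exact ⟨r, rfl, cross_ne_zero hK⟩

open Classical in
lemma exists_vertices {K : Finset Plane} (hK : K ∈ T.tri) :
    ∃ p q r, K = {p, q, r} ∧ p ≠ q ∧ p ≠ r ∧ q ≠ r ∧ cross (q - p) (r - p) ≠ 0 := by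
  obtain ⟨p, q, r, h1, h2, h3, rfl⟩ := Finset.card_eq_three.1 (T.mem_tri.1 hK).2
  exact ⟨p, q, r, rfl, h1, h2, h3, cross_ne_zero hK⟩

lemma mem_space {x : Plane} : x ∈ T.space ↔ ∃ K ∈ T.tri, x ∈ hull K := by
  rw [Geometry.SimplicialComplex.mem_space_iff]
  constructor
  · rintro ⟨s, hs, hx⟩
    obtain ⟨t, ht, hst, hc⟩ := T.pure_two s hs
    exact ⟨t, T.mem_tri.2 ⟨ht, hc⟩, convexHull_mono (by exact_mod_cast hst) hx⟩
  · rintro ⟨K, hK, hx⟩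
    exact ⟨K, (T.mem_tri.1 hK).1, hx⟩

lemma hull_subset_space {K : Finset Plane} (hK : K ∈ T.tri) : hull K ⊆ T.space :=
  fun _ hx => T.mem_space.2 ⟨K, hK, hx⟩

lemma space_eq_biUnion (T : Triangulation) : T.space = ⋃ K ∈ T.tri, hull K := by
  ext x; simp [mem_space]

lemma isCompact_space (T : Triangulation) : IsCompact T.space := by
  rw [space_eq_biUnion]
  exact T.tri.isCompact_biUnion fun K _ => isCompact_hull K

open Classical in
/-- The interior of a triangle does not meet another triangle. -/
lemma eq_of_mem_interior_hull {K K' : Finset Plane} (hK : K ∈ T.tri) (hK' : K' ∈ T.tri) {x : Plane}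
    (hx : x ∈ interior (hull K)) (hx' : x ∈ hull K') : K = K' := by
  by_contra hne
  obtain ⟨hf, hc⟩ := T.mem_tri.1 hK
  obtain ⟨hf', hc'⟩ := T.mem_tri.1 hK'
  have hnot : ¬ K ⊆ K' := fun h => hne (Finset.eq_of_subset_of_card_le h (by omega))
  obtain ⟨r, hr, hr'⟩ := Finset.not_subset.1 hnot
  have h2 : (K.erase r).card = 2 := by rw [Finset.card_erase_of_mem hr, hc]
  obtain ⟨p, q, hpq, he⟩ := Finset.card_eq_two.1 h2
  have hKe : K = {p, q, r} := by
    rw [← Finset.insert_erase hr, he]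
    ext x; simp; tauto
  have hcr : cross (q - p) (r - p) ≠ 0 := cross_ne_zero (hKe ▸ hK)
  -- By conformity `x` is in the hull of the common vertices. These do not include `r`, so the
  -- coordinate of `r` vanishes at `x`, whereas it is positive in the interior.
  have hmem := T.inter_subset_convexHull hf hf' ⟨interior_subset hx, hx'⟩
  have hsub : (K : Set Plane) ∩ K' ⊆ {x | bary p q r x = 0} := by
    rintro y ⟨hy, hy'⟩
    have : y ∈ K.erase r := Finset.mem_erase.2 ⟨fun h => hr' (h ▸ hy'), hy⟩
    rw [he] at this
    rcases Finset.mem_insert.1 this with rfl | h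
    · exact bary_left _ _ _
    · rw [Finset.mem_singleton.1 h]; exact bary_right _ _ _
  have hconv : Convex ℝ {x | bary p q r x = 0} := by
    intro y hy z hz a b _ _ hab
    have hy : bary p q r y = 0 := hy
    have hz : bary p q r z = 0 := hz
    change bary p q r _ = 0
    rw [bary_affine hab, hy, hz]; simp
  have h0 : bary p q r x = 0 := convexHull_min hsub hconv hmem
  rw [hKe, hull_triple] at hx
  exact (bary_pos_of_mem_interior hcr hx).ne' h0

open Classical in
/-- The divergence theorem on a triangle of a triangulation, for any choice of directions of the
edges. -/
lemma exists_flux_coeff {K : Finset Plane} (hK : K ∈ T.tri) (A B : Finset Plane → Plane)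
    (hAB : ∀ s : Finset Plane, s.card = 2 → s = {A s, B s}) :
    ∃ κ : Finset Plane → ℝ, ∀ (φ : VField) (C : NNReal), LipschitzWith C φ →
      ∫ x in hull K, divJ (jet φ) x =
        ∑ s ∈ K.powersetCard 2, κ s * segFlux (A s) (B s) φ := by
  obtain ⟨a, b, c, rfl, hab, hac, hbc, hD⟩ := exists_vertices hK
  set D := cross (b - a) (c - a)
  -- The sign compares the prescribed direction of an edge with the cyclic order `a → b → c`. The
  -- resulting coefficients do not depend on the field, so they can be shared by `φ` and by the
  -- cut-off fields.
  let dir : Finset Plane → ℝ := fun s =>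
    if (A s, B s) = (a, b) ∨ (A s, B s) = (b, c) ∨ (A s, B s) = (c, a) then 1 else -1
  refine ⟨fun s => |D| / D * dir s, fun φ C hφ => ?_⟩
  have hpow : ({a, b, c} : Finset Plane).powersetCard 2 = {{a, b}, {b, c}, {c, a}} := by
    ext s
    rw [Finset.mem_powersetCard]
    constructor
    · rintro ⟨hs, h2⟩
      obtain ⟨x, y, hxy, rfl⟩ := Finset.card_eq_two.1 h2
      have hx := hs (Finset.mem_insert_self x {y})
      have hy := hs (Finset.mem_insert_of_mem (Finset.mem_singleton_self y))
      simp only [Finset.mem_insert, Finset.mem_singleton] at hx hy ⊢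
      have := Finset.pair_comm x y
      grind
    · intro hs
      simp only [Finset.mem_insert, Finset.mem_singleton] at hs
      rcases hs with rfl | rfl | rfl
      · exact ⟨by intro; simp; tauto, Finset.card_pair hab⟩
      · exact ⟨by intro; simp; tauto, Finset.card_pair hbc⟩
      · exact ⟨by intro; simp; tauto, Finset.card_pair hac.symm⟩
  have hpair : ∀ {x y z w : Plane}, ({x, y} : Finset Plane) = {z, w} →
      (x = z ∧ y = w) ∨ (x = w ∧ y = z) := by
    intro x y z w h
    have : ({x, y} : Set Plane) = {z, w} := by
      have := congrArg (fun s : Finset Plane => (s : Set Plane)) h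
      simpa using this
    exact Set.pair_eq_pair_iff.1 this
  have key : ∀ x y, x ≠ y → ((x, y) = (a, b) ∨ (x, y) = (b, c) ∨ (x, y) = (c, a)) →
      dir {x, y} * segFlux (A {x, y}) (B {x, y}) φ = segFlux x y φ := by
    intro x y hxy hmem
    rcases hpair (hAB {x, y} (Finset.card_pair hxy)) with ⟨h1, h2⟩ | ⟨h1, h2⟩
    · have hd : dir {x, y} = 1 := by
        simp only [dir]
        rw [if_pos]; rw [← h1, ← h2]; exact hmem
      rw [hd, ← h1, ← h2, one_mul]
    · have hd : dir {x, y} = -1 := by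
        simp only [dir]
        rw [if_neg]; rw [← h1, ← h2]
        simp only [Prod.mk.injEq] at hmem ⊢
        grind
      rw [hd, ← h1, ← h2, segFlux_swap x y]; ring
  have n1 : ({a, b} : Finset Plane) ∉ ({{b, c}, {c, a}} : Finset (Finset Plane)) := by
    simp only [Finset.mem_insert, Finset.mem_singleton]
    rintro (h | h) <;> rcases hpair h with h | h <;> grind
  have n2 : ({b, c} : Finset Plane) ∉ ({{c, a}} : Finset (Finset Plane)) := by
    simp only [Finset.mem_singleton]
    intro h; rcases hpair h with h | h <;> grind
  rw [hull_triple, setIntegral_div_triangle hφ hD, hpow, Finset.sum_insert n1,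
    Finset.sum_insert n2, Finset.sum_singleton, mul_assoc, mul_assoc, mul_assoc,
    key a b hab (by simp), key b c hbc (by simp), key c a hac.symm (by simp)]
  ring

end Triangulation

/-! ### Perforated elements and the decomposition of the domain up to null sets -/

namespace PerforatedMesh

variable {P : PerforatedMesh}

lemma mem_fineTris {fine : Triangulation} {K t : Finset Plane} :
    t ∈ fineTris fine K ↔ t ∈ fine.tri ∧ hull t ⊆ hull K := by
  simp [fineTris]

lemma mem_block {K : Finset Plane} {x : Plane} :
    x ∈ P.block K ↔ ∃ t ∈ fineTris P.fine K, x ∈ hull t := by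
  simp [block, blockOf]

lemma block_subset_hull (K : Finset Plane) : P.block K ⊆ hull K := by
  intro x hx
  obtain ⟨t, ht, hxt⟩ := mem_block.1 hx
  exact (mem_fineTris.1 ht).2 hxt

lemma isCompact_block (K : Finset Plane) : IsCompact (P.block K) :=
  (fineTris P.fine K).isCompact_biUnion fun t _ => isCompact_hull t

lemma isClosed_block (K : Finset Plane) : IsClosed (P.block K) := (isCompact_block K).isClosed

lemma block_subset_closedDomain (K : Finset Plane) : P.block K ⊆ P.closedDomain := by
  intro x hx
  obtain ⟨t, ht, hxt⟩ := mem_block.1 hx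
  exact P.fine.hull_subset_space (mem_fineTris.1 ht).1 hxt

lemma exists_mem_block {x : Plane} (hx : x ∈ P.closedDomain) : ∃ K ∈ P.coarse.tri, x ∈ P.block K := by
  obtain ⟨t, ht, hxt⟩ := P.fine.mem_space.1 hx
  obtain ⟨K, hK, htK⟩ := P.refines t ht
  exact ⟨K, hK, mem_block.2 ⟨t, mem_fineTris.2 ⟨ht, htK⟩, hxt⟩⟩

lemma closedDomain_subset_coarse : P.closedDomain ⊆ P.coarse.space := by
  intro x hx
  obtain ⟨K, hK, hxK⟩ := exists_mem_block hx
  exact P.coarse.hull_subset_space hK (block_subset_hull K hxK)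

lemma isCompact_closedDomain : IsCompact P.closedDomain := P.fine.isCompact_space

lemma domain_subset : P.domain ⊆ P.closedDomain := interior_subset

lemma isOpen_domain : IsOpen P.domain := isOpen_interior

lemma isBounded_domain : Bornology.IsBounded P.domain :=
  isCompact_closedDomain.isBounded.subset domain_subset

lemma interior_block_subset_domain (K : Finset Plane) : interior (P.block K) ⊆ P.domain :=
  interior_mono (block_subset_closedDomain K)

lemma interior_block_subset_hull (K : Finset Plane) : interior (P.block K) ⊆ interior (hull K) :=
  interior_mono (block_subset_hull K)

/-- The union of the boundaries of the fine triangles. -/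
def skeleton (P : PerforatedMesh) : Set Plane := ⋃ t ∈ P.fine.tri, frontier (hull t)

lemma volume_skeleton : volume P.skeleton = 0 :=
  (measure_biUnion_null_iff P.fine.tri.countable_toSet).2 fun t _ => volume_frontier_hull t

lemma ae_notMem_skeleton : ∀ᵐ x, x ∉ P.skeleton := measure_eq_zero_iff_ae_notMem.1 volume_skeleton

/-- Off the null set of fine triangle boundaries, a point of a block is interior to a fine triangle.
This is why blocks, their interiors and the domain can be interchanged in integrals. -/
lemma mem_interior_block {K : Finset Plane} {x : Plane} (hx : x ∈ P.block K)
    (hs : x ∉ P.skeleton) : x ∈ interior (P.block K) := by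
  obtain ⟨t, ht, hxt⟩ := mem_block.1 hx
  have hint : x ∈ interior (hull t) := by
    by_contra hne
    refine hs (Set.mem_biUnion (mem_fineTris.1 ht).1 ?_)
    rw [(isClosed_hull t).frontier_eq]
    exact ⟨hxt, hne⟩
  have hsub : hull t ⊆ P.block K := fun y hy => mem_block.2 ⟨t, ht, hy⟩
  exact interior_mono hsub hint

lemma domain_ae_eq : P.domain =ᵐ[volume] ⋃ K ∈ P.coarse.tri, interior (P.block K) := by
  filter_upwards [ae_notMem_skeleton (P := P)] with x hx
  refine propext ⟨fun h => ?_, fun h => ?_⟩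
  · obtain ⟨K, hK, hxK⟩ := exists_mem_block (domain_subset h)
    exact Set.mem_biUnion hK (mem_interior_block hxK hx)
  · obtain ⟨K, -, hxK⟩ := Set.mem_iUnion₂.1 h
    exact interior_block_subset_domain K hxK

lemma pairwiseDisjoint_interior_block :
    Set.PairwiseDisjoint (P.coarse.tri : Set (Finset Plane)) fun K => interior (P.block K) := by
  intro K hK K' hK' hne
  refine Set.disjoint_left.2 fun x hx hx' => hne ?_
  exact Triangulation.eq_of_mem_interior_hull hK hK' (interior_block_subset_hull K hx)
    (interior_subset (interior_block_subset_hull K' hx'))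

lemma setIntegral_domain_eq_sum {F : Plane → ℝ} (hF : IntegrableOn F P.domain) :
    ∫ x in P.domain, F x = ∑ K ∈ P.coarse.tri, ∫ x in interior (P.block K), F x := by
  rw [setIntegral_congr_set domain_ae_eq, integral_biUnion_finset]
  · exact fun K _ => isOpen_interior.measurableSet
  · exact pairwiseDisjoint_interior_block
  · exact fun K _ => hF.mono_set (interior_block_subset_domain K)

/-! ### Neighborhoods of edges -/

lemma mem_nbhd {s : Finset Plane} {x : Plane} :
    x ∈ P.nbhd s ↔ ∃ K ∈ P.coarse.tri, s ⊆ K ∧ x ∈ P.block K := by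
  simp only [nbhd, Set.mem_iUnion, exists_prop]

lemma nbhd_subset_closedDomain (s : Finset Plane) : P.nbhd s ⊆ P.closedDomain := by
  intro x hx
  obtain ⟨K, -, -, h⟩ := mem_nbhd.1 hx
  exact block_subset_closedDomain K h

lemma block_subset_nbhd {s K : Finset Plane} (hK : K ∈ P.coarse.tri) (hs : s ⊆ K) :
    P.block K ⊆ P.nbhd s := fun _ hx => mem_nbhd.2 ⟨K, hK, hs, hx⟩

lemma isClosed_nbhd (s : Finset Plane) : IsClosed (P.nbhd s) := by
  classical
  have : P.nbhd s = ⋃ K ∈ P.coarse.tri.filter (fun K => s ⊆ K), P.block K := by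
    ext x
    rw [mem_nbhd]
    simp only [Set.mem_iUnion, Finset.mem_filter, exists_prop, and_assoc]
  rw [this]
  exact (P.coarse.tri.filter _).isCompact_biUnion (fun K _ => isCompact_block K) |>.isClosed

lemma isCompact_nbhd (s : Finset Plane) : IsCompact (P.nbhd s) :=
  isCompact_closedDomain.of_isClosed_subset (isClosed_nbhd s) (nbhd_subset_closedDomain s)

lemma mem_block_of_mem_nbhd {s K : Finset Plane} (hK : K ∈ P.coarse.tri) {x : Plane}
    (hx : x ∈ interior (hull K)) (hn : x ∈ P.nbhd s) : s ⊆ K ∧ x ∈ P.block K := by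
  obtain ⟨K', hK', hs, hxb⟩ := mem_nbhd.1 hn
  obtain rfl := Triangulation.eq_of_mem_interior_hull hK hK' hx (block_subset_hull K' hxb)
  exact ⟨hs, hxb⟩

open Classical in
/-- An interior coarse edge has a triangle on each side. -/
lemma exists_opposite_triangle {s : Finset Plane} (hs : P.IsInteriorEdge s) {p q r : Plane}
    (hpq : s = {p, q}) (hr : cross (q - p) (r - p) ≠ 0) :
    ∃ r', ({p, q, r'} : Finset Plane) ∈ P.coarse.tri ∧
      cross (q - p) (r' - p) / cross (q - p) (r - p) < 0 := by
  obtain ⟨hface, hcard, x₀, hx₀, hx₀d⟩ := hs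
  have hpq' : p ≠ q := by
    rintro rfl; rw [hpq] at hcard; simp at hcard
  subst hpq
  -- The domain is open, so the edge also meets it at a point other than its two ends.
  obtain ⟨θ, hθ, hθd⟩ : ∃ θ ∈ Set.Ioo (0 : ℝ) 1, p + θ • (q - p) ∈ P.domain := by
    rw [hull_pair, segment_eq_image'] at hx₀
    obtain ⟨θ₀, hθ₀, rfl⟩ := hx₀
    have hc : Continuous fun θ : ℝ => p + θ • (q - p) := by fun_prop
    have hopen := (isOpen_domain (P := P)).preimage hc
    have hcl : θ₀ ∈ closure (Set.Ioo (0 : ℝ) 1) := by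
      rwa [closure_Ioo (by norm_num)]
    obtain ⟨θ, h1, h2⟩ := mem_closure_iff.1 hcl _ hopen hx₀d
    exact ⟨θ, h2, h1⟩
  set x₁ := p + θ • (q - p) with hx₁
  have hb1 : bary p q r x₁ = 0 := by
    rw [bary, div_eq_zero_iff]; left
    simp only [hx₁, cross, PiLp.sub_apply, PiLp.add_apply, PiLp.smul_apply, smul_eq_mul]; ring
  -- Points just across the edge from `r` are still in the domain, hence in coarse triangles. As
  -- there are finitely many triangles, one of them accumulates at `x₁` from that side.
  have hcl : x₁ ∈ closure (⋃ K ∈ P.coarse.tri, hull K ∩ {x | bary p q r x < 0}) := by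
    have hc : Continuous fun η : ℝ => x₁ - η • (r - p) := by fun_prop
    have hev : ∀ᶠ η : ℝ in nhdsWithin 0 (Set.Ioi 0), x₁ - η • (r - p) ∈ P.domain :=
      nhdsWithin_le_nhds (hc.continuousAt.eventually_mem
        (isOpen_domain.mem_nhds (by simpa using hθd)))
    have ht : Filter.Tendsto (fun η : ℝ => x₁ - η • (r - p)) (nhdsWithin 0 (Set.Ioi 0))
        (nhds x₁) := by
      have := hc.tendsto 0
      simp only [zero_smul, sub_zero] at this
      exact this.mono_left nhdsWithin_le_nhds
    refine mem_closure_of_tendsto ht ?_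
    filter_upwards [hev, self_mem_nhdsWithin] with η hη hη0
    obtain ⟨K, hK, hxK⟩ := P.coarse.mem_space.1 (closedDomain_subset_coarse (domain_subset hη))
    refine Set.mem_biUnion hK ⟨hxK, ?_⟩
    have hη0 : (0 : ℝ) < η := hη0
    have : bary p q r (x₁ - η • (r - p)) = bary p q r x₁ - η := by
      simp only [bary]
      rw [eq_sub_iff_add_eq, div_add' _ _ _ hr]
      congr 1
      simp only [cross, PiLp.sub_apply, PiLp.smul_apply, smul_eq_mul]
      ring
    change bary p q r (x₁ - η • (r - p)) < 0
    linarith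
  rw [Finset.closure_biUnion] at hcl
  obtain ⟨K, hK, hxK⟩ := Set.mem_iUnion₂.1 hcl
  have hxK' : x₁ ∈ hull K := by
    have := closure_mono Set.inter_subset_left hxK
    rwa [(isClosed_hull K).closure_eq] at this
  obtain ⟨y, hyK, hy⟩ := closure_nonempty_iff.1 ⟨x₁, hxK⟩
  have hx₁s : x₁ ∈ hull ({p, q} : Finset Plane) := by
    rw [hull_pair, segment_eq_image']
    exact ⟨θ, ⟨hθ.1.le, hθ.2.le⟩, rfl⟩
  -- By conformity `x₁` is in the hull of the common vertices of the edge and `K`. If `K` missed an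
  -- end point, `x₁` would be the other end point, contrary to `0 < θ < 1`.
  have hmem := P.coarse.inter_subset_convexHull hface (P.coarse.mem_tri.1 hK).1 ⟨hx₁s, hxK'⟩
  have hne : ∀ z : Plane, ((({p, q} : Finset Plane) : Set Plane) ∩ K ⊆ {z}) → x₁ = z := by
    intro z hsub
    have := convexHull_mono (𝕜 := ℝ) hsub hmem
    simpa using this
  have hpqK : ({p, q} : Finset Plane) ⊆ K := by
    intro z hz
    by_contra hzK
    have hθ0 := hθ.1
    have hθ1 := hθ.2
    rcases Finset.mem_insert.1 hz with rfl | hz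
    · have h1 := hne q (by
        rintro w ⟨hw, hwK⟩
        simp only [Finset.coe_insert, Finset.coe_singleton, Set.mem_insert_iff,
          Set.mem_singleton_iff] at hw
        rcases hw with rfl | rfl
        · exact absurd hwK hzK
        · rfl)
      have h2 : (1 - θ) • (q - z) = 0 := by
        have : (1 - θ) • (q - z) = q - x₁ := by rw [hx₁]; module
        rw [this, h1, sub_self]
      rcases smul_eq_zero.1 h2 with h3 | h3
      · linarith
      · exact hpq' (sub_eq_zero.1 h3).symm
    · rw [Finset.mem_singleton] at hz
      subst hz
      have h1 := hne p (by
        rintro w ⟨hw, hwK⟩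
        simp only [Finset.coe_insert, Finset.coe_singleton, Set.mem_insert_iff,
          Set.mem_singleton_iff] at hw
        rcases hw with rfl | rfl
        · rfl
        · exact absurd hwK hzK)
      have h2 : θ • (z - p) = 0 := by
        have : θ • (z - p) = x₁ - p := by rw [hx₁]; module
        rw [this, h1, sub_self]
      rcases smul_eq_zero.1 h2 with h3 | h3
      · linarith
      · exact hpq' (sub_eq_zero.1 h3).symm
  -- The triangle `K` has a point `y` strictly across the edge from `r`, so its third vertex is on
  -- that side too.
  obtain ⟨r', rfl, hr'⟩ := Triangulation.exists_third_vertex hK hpqK rfl hcard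
  refine ⟨r', hK, ?_⟩
  rw [hull_triple, mem_triangle_iff hr'] at hyK
  have hy : cross (q - p) (y - p) / cross (q - p) (r - p) < 0 := hy
  have h3 : 0 ≤ cross (q - p) (y - p) / cross (q - p) (r' - p) := hyK.2.2
  by_contra! h4
  have h5 := mul_nonneg h3 h4
  rw [div_mul_div_cancel₀ hr'] at h5
  linarith

open Classical in
/-- The relative interior of an interior coarse edge is in the interior of the unperforated
domain. -/
lemma mem_interior_coarse_of_edge {s : Finset Plane} (hs : P.IsInteriorEdge s) {p q r : Plane}
    (hpq : s = {p, q}) (hr : ({p, q, r} : Finset Plane) ∈ P.coarse.tri) {x : Plane}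
    (hp : 0 < bary q r p x) (hq : 0 < bary r p q x) (h0 : bary p q r x = 0) :
    x ∈ interior P.coarse.space := by
  have hD := Triangulation.cross_ne_zero hr
  obtain ⟨r', hr', hneg⟩ := exists_opposite_triangle hs hpq hD
  have hD' := Triangulation.cross_ne_zero hr'
  have hc0 : cross (q - p) (x - p) = 0 := (div_eq_zero_iff.1 h0).resolve_right hD
  have hxe := bary_combination hD x
  have hsum := bary_sum hD x
  rw [h0] at hxe hsum
  -- On the common edge the coordinates of `p` and `q` are the same in both triangles.
  have hp' : bary q r' p x = bary q r p x := by
    have : x = bary q r p x • p + bary r p q x • q := by simpa using hxe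
    conv_lhs => rw [this]
    rw [bary_affine (by linarith), bary_self (by rwa [cross_rotate]), bary_left]; ring
  have hq' : bary r' p q x = bary r p q x := by
    have : x = bary q r p x • p + bary r p q x • q := by simpa using hxe
    conv_lhs => rw [this]
    rw [bary_affine (by linarith), bary_self (by rwa [cross_rotate, cross_rotate]), bary_right]
    ring
  rw [mem_interior_iff_mem_nhds]
  have o : ∀ a b c : Plane, 0 < bary a b c x → ∀ᶠ y in nhds x, 0 < bary a b c y := fun a b c h =>
    (continuous_bary a b c).continuousAt.eventually (lt_mem_nhds h)
  -- Near `x` the coordinates of `p` and `q` stay positive in both triangles, so the side of the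
  -- edge decides which triangle contains `y`.
  filter_upwards [o _ _ _ hp, o _ _ _ hq, o _ _ _ (hp' ▸ hp), o _ _ _ (hq' ▸ hq)] with y h1 h2 h3 h4
  rcases le_or_gt 0 (bary p q r y) with h5 | h5
  · refine P.coarse.hull_subset_space hr ?_
    rw [hull_triple, mem_triangle_iff hD]
    exact ⟨h1.le, h2.le, h5⟩
  · refine P.coarse.hull_subset_space hr' ?_
    rw [hull_triple, mem_triangle_iff hD']
    refine ⟨h3.le, h4.le, ?_⟩
    have h6 : bary p q r y = bary p q r' y * (cross (q - p) (r' - p) / cross (q - p) (r - p)) := by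
      rw [bary, bary, div_mul_div_cancel₀ hD']
    rw [h6] at h5
    by_contra! h7
    exact absurd h5 (not_lt.2 (mul_nonneg_of_nonpos_of_nonpos h7.le hneg.le))

end PerforatedMesh

/-! ## Cut-off eigenfunctions -/

lemma exists_lipschitzOnWith_mul {E : Type*} [PseudoMetricSpace E] {f g : E → ℝ} {S : Set E}
    (hS : IsCompact S) (hf : ∃ C, LipschitzOnWith C f S) (hg : ∃ C, LipschitzOnWith C g S) :
    ∃ C, LipschitzOnWith C (fun x => f x * g x) S := by
  obtain ⟨C, hf⟩ := hf
  obtain ⟨D, hg⟩ := hg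
  obtain ⟨M, hM⟩ := hS.exists_bound_of_continuousOn hf.continuousOn
  obtain ⟨N, hN⟩ := hS.exists_bound_of_continuousOn hg.continuousOn
  refine ⟨M.toNNReal * D + N.toNNReal * C, LipschitzOnWith.of_dist_le_mul fun x hx y hy => ?_⟩
  have h1 := hf.dist_le_mul x hx y hy
  have h2 := hg.dist_le_mul x hx y hy
  have hM0 : 0 ≤ M := (norm_nonneg _).trans (hM x hx)
  have hN0 : 0 ≤ N := (norm_nonneg _).trans (hN x hx)
  rw [Real.dist_eq] at h1 h2 ⊢
  have e : f x * g x - f y * g y = f x * (g x - g y) + g y * (f x - f y) := by ring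
  rw [e]
  refine (abs_add_le _ _).trans ?_
  rw [abs_mul, abs_mul]
  push_cast
  rw [Real.coe_toNNReal _ hM0, Real.coe_toNNReal _ hN0, add_mul, mul_assoc, mul_assoc]
  have h3 : |f x| ≤ M := hM x hx
  have h4 : |g y| ≤ N := hN y hy
  gcongr

lemma exists_lipschitzOnWith_mvPolynomial (f : MvPolynomial (Fin 2) ℝ) {S : Set Plane}
    (hS : IsCompact S) :
    ∃ C, LipschitzOnWith C (fun x : Plane => MvPolynomial.eval (fun i => x i) f) S := by
  induction f using MvPolynomial.induction_on with
  | C a => exact ⟨0, by simp⟩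
  | add p q hp hq =>
    obtain ⟨C, hp⟩ := hp
    obtain ⟨D, hq⟩ := hq
    exact ⟨C + D, by simpa using hp.add hq⟩
  | mul_X p n hp =>
    simp only [map_mul, MvPolynomial.eval_X]
    refine exists_lipschitzOnWith_mul hS hp
      ⟨_, ((EuclideanSpace.proj n : Plane →L[ℝ] ℝ).lipschitz).lipschitzOnWith⟩

namespace PerforatedMesh

variable {P : PerforatedMesh}

lemma IsVh.zero (s : Finset Plane) : P.IsVh s 0 :=
  ⟨continuousOn_const, fun _ _ _ => ⟨0, by simp, by simp⟩, fun _ _ => rfl, fun _ _ => rfl⟩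

lemma IsVh.add {s : Finset Plane} {u v : VField} (hu : P.IsVh s u) (hv : P.IsVh s v) :
    P.IsVh s (u + v) := by
  refine ⟨hu.1.add hv.1, fun t ht a => ?_, fun x hx => ?_, fun x hx => ?_⟩
  · obtain ⟨f, hf, hfe⟩ := hu.2.1 t ht a
    obtain ⟨g, hg, hge⟩ := hv.2.1 t ht a
    refine ⟨f + g, (MvPolynomial.totalDegree_add f g).trans (max_le hf hg), fun x hx => ?_⟩
    simp [hfe x hx, hge x hx]
  · simp [hu.2.2.1 x hx, hv.2.2.1 x hx]
  · simp [hu.2.2.2 x hx, hv.2.2.2 x hx]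

lemma IsVh.smul {s : Finset Plane} {u : VField} (c : ℝ) (hu : P.IsVh s u) : P.IsVh s (c • u) := by
  refine ⟨hu.1.const_smul c, fun t ht a => ?_, fun x hx => ?_, fun x hx => ?_⟩
  · obtain ⟨f, hf, hfe⟩ := hu.2.1 t ht a
    refine ⟨c • f, (MvPolynomial.totalDegree_smul_le c f).trans hf, fun x hx => ?_⟩
    simp [hfe x hx]
  · simp [hu.2.2.1 x hx]
  · simp [hu.2.2.2 x hx]

lemma IsInteriorEdge.isNodeOrEdge {s : Finset Plane} (h : P.IsInteriorEdge s) : P.IsNodeOrEdge s :=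
  ⟨h.1, h.2.1.le⟩

/-- The fine-grid velocities form a linear space that contains the snapshots, hence their span. -/
lemma OfflineData.isVh_eigfun (O : P.OfflineData) {s : Finset Plane} (hs : P.IsNodeOrEdge s)
    {k : ℕ} (hk : k < O.M s) : P.IsVh s (O.eigfun s k) := by
  have hmem := (O.eig_spec s hs k hk).1
  refine Submodule.span_induction (p := fun w _ => P.IsVh s w) ?_ (IsVh.zero s)
    (fun _ _ _ _ h h' => h.add h') (fun c _ _ h => h.smul c) hmem
  rintro w ⟨e, a, he, rfl⟩
  exact (O.snap_spec s hs (by omega) e he a).1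

lemma cutoff_eq_zero_of_notMem_nbhd {s : Finset Plane} {χ : Plane → ℝ} {w : VField}
    (hw : P.IsVh s w) (a : Fin 2) {x : Plane} (hx : x ∉ P.nbhd s) : cutoff χ w a x = 0 := by
  ext b
  simp [cutoff, hw.2.2.2 x hx]

/-- The cut-off field vanishes on the coarse faces that do not contain `s`. -/
lemma cutoff_eq_zero_of_mem_face (pou : P.PartitionOfUnity) {s : Finset Plane}
    (hs : P.IsNodeOrEdge s) {w : VField} (hw : P.IsVh s w) (a : Fin 2) {F : Finset Plane}
    (hF : F ∈ P.coarse.faces) (hsF : ¬ s ⊆ F) {x : Plane} (hx : x ∈ hull F) :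
    cutoff (pou.χ s) w a x = 0 := by
  by_cases hd : x ∈ P.closedDomain
  · ext b
    simp [cutoff, pou.vanish s hs F hF hsF x ⟨hx, hd⟩]
  · exact cutoff_eq_zero_of_notMem_nbhd hw a fun h => hd (nbhd_subset_closedDomain s h)

/-- The three ways to leave a neighborhood: out of `Ω`, into a perforation, or into an element that
does not contain `s`. The cut-off vanishes at the closure of each for a different reason. -/
lemma compl_nbhd_subset (s : Finset Plane) :
    (P.nbhd s)ᶜ ⊆ (P.coarse.space)ᶜ ∪ ((P.coarse.space \ P.closedDomain) ∪
      ⋃ K ∈ P.coarse.tri, {x | x ∈ P.block K ∧ ¬ s ⊆ K}) := by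
  intro y hy
  by_cases hc : y ∈ P.coarse.space
  · right
    by_cases hd : y ∈ P.closedDomain
    · right
      obtain ⟨K, hK, hyK⟩ := exists_mem_block hd
      exact Set.mem_biUnion hK ⟨hyK, fun hs => hy (mem_nbhd.2 ⟨K, hK, hs, hyK⟩)⟩
    · exact Or.inl ⟨hc, hd⟩
  · exact Or.inl hc

open Classical in
/-- The cut-off field of an interior edge vanishes on the boundary of its neighborhood. -/
lemma cutoff_eq_zero_of_mem_closure_compl (pou : P.PartitionOfUnity) {s : Finset Plane}
    (hs : P.IsInteriorEdge s) {w : VField} (hw : P.IsVh s w) (a : Fin 2) {x : Plane}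
    (hx : x ∈ closure (P.nbhd s)ᶜ) : cutoff (pou.χ s) w a x = 0 := by
  by_cases hn : x ∈ P.nbhd s
  swap
  · exact cutoff_eq_zero_of_notMem_nbhd hw a hn
  have hne := hs.isNodeOrEdge
  have h1 := closure_mono (compl_nbhd_subset s) hx
  rw [closure_union, closure_union, Finset.closure_biUnion] at h1
  rcases h1 with h1 | h1 | h1
  -- The point adheres to the exterior of `Ω`. On the two sides other than `s` the partition
  -- function vanishes; any other point of `K` is inside `K` or relatively interior to `s`, hence
  -- interior to `Ω`, which is impossible.
  · obtain ⟨K, hK, hsK, hxK⟩ := mem_nbhd.1 hn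
    obtain ⟨p, q, hpq, rfl⟩ := Finset.card_eq_two.1 hs.2.1
    obtain ⟨r, rfl, hD⟩ := Triangulation.exists_third_vertex hK hsK rfl hs.2.1
    have hxh := block_subset_hull _ hxK
    have hKf := (P.coarse.mem_tri.1 hK).1
    obtain ⟨n1, n2, n3⟩ := Finset.card_triple_eq_three_iff.1 (P.coarse.mem_tri.1 hK).2
    rw [hull_triple, mem_triangle_iff hD] at hxh
    have hcomb := bary_combination hD x
    have hsum := bary_sum hD x
    have face : ∀ u v : Plane, ({u, v} : Finset Plane) ⊆ {p, q, r} →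
        ¬ ({p, q} : Finset Plane) ⊆ {u, v} → x ∈ segment ℝ u v →
        cutoff (pou.χ {p, q}) w a x = 0 := by
      intro u v huv hnot hxs
      refine cutoff_eq_zero_of_mem_face pou hne hw a (F := {u, v})
        (P.coarse.down_closed hKf huv (by simp)) hnot ?_
      rwa [hull_pair]
    rcases hxh.1.eq_or_lt with h0 | hp
    · refine face q r (by intro; simp; tauto) ?_ ?_
      · intro h; have := h (Finset.mem_insert_self p {q}); simp [n1, n2] at this
      · rw [← h0, zero_smul, zero_add] at hcomb
        rw [← h0, zero_add] at hsum
        exact ⟨_, _, hxh.2.1, hxh.2.2, hsum, hcomb.symm⟩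
    rcases hxh.2.1.eq_or_lt with h0 | hq
    · refine face p r (by intro; simp; tauto) ?_ ?_
      · intro h
        have := h (Finset.mem_insert_of_mem (Finset.mem_singleton_self q))
        simp [n3, n1.symm] at this
      · rw [← h0, zero_smul, add_zero] at hcomb
        rw [← h0, add_zero] at hsum
        exact ⟨_, _, hxh.1, hxh.2.2, hsum, hcomb.symm⟩
    exfalso
    rw [closure_compl] at h1
    refine h1 ?_
    rcases hxh.2.2.eq_or_lt with h0 | hr
    · exact mem_interior_coarse_of_edge hs rfl hK hp hq h0.symm
    · have := mem_interior_triangle hD hp hq hr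
      rw [← hull_triple] at this
      exact interior_mono (P.coarse.hull_subset_space hK) this
  · have hh : x ∈ P.holeBoundary := ⟨nbhd_subset_closedDomain s hn, h1⟩
    ext b
    simp [cutoff, hw.2.2.1 x ⟨hn, hh⟩]
  -- The set is either the closed block of `K` or empty; being nonempty, it yields that `s` is not
  -- contained in `K`, and the partition function vanishes on `K`.
  · obtain ⟨K, hK, hxK⟩ := Set.mem_iUnion₂.1 h1
    obtain ⟨y, hy, hsK⟩ := closure_nonempty_iff.1 ⟨x, hxK⟩
    have hxb : x ∈ P.block K := by
      have := closure_mono (show {x | x ∈ P.block K ∧ ¬ s ⊆ K} ⊆ P.block K from fun z hz => hz.1) hxK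
      rwa [(isClosed_block K).closure_eq] at this
    exact cutoff_eq_zero_of_mem_face pou hne hw a (P.coarse.mem_tri.1 hK).1 hsK
      (block_subset_hull K hxb)

-- On a fine triangle the product is a Lipschitz function times a polynomial, and on the closure of
-- the complement of the neighborhood it is zero. These finitely many closed sets cover the plane.
-- Global Lipschitz continuity makes the divergence theorem available on whole coarse triangles,
-- perforations included.
open Classical in
lemma exists_lipschitzWith_cutoff (pou : P.PartitionOfUnity) {s : Finset Plane}
    (hs : P.IsInteriorEdge s) {w : VField} (hw : P.IsVh s w) (a : Fin 2) :
    ∃ C, LipschitzWith C (cutoff (pou.χ s) w a) := by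
  have key : ∃ C, LipschitzWith C fun x => pou.χ s x * w x a := by
    set I : Finset (Finset Plane) := P.fine.tri.filter fun t => P.IsFineTriOf s t
    refine exists_lipschitzWith_of_closed_cover (insert none (I.image some))
      (fun i : Option (Finset Plane) => i.elim (closure (P.nbhd s)ᶜ) fun t => hull t) ?_ ?_ ?_
    · rintro (_ | t) -
      · exact isClosed_closure
      · exact isClosed_hull t
    · intro x
      by_cases hx : x ∈ P.nbhd s
      · obtain ⟨K, hK, hsK, hxK⟩ := mem_nbhd.1 hx
        obtain ⟨t, ht, hxt⟩ := mem_block.1 hxK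
        refine ⟨some t, ?_, hxt⟩
        refine Finset.mem_insert_of_mem (Finset.mem_image_of_mem _ (Finset.mem_filter.2 ⟨?_, ?_⟩))
        · exact (mem_fineTris.1 ht).1
        · exact ⟨K, hK, hsK, ht⟩
      · exact ⟨none, Finset.mem_insert_self _ _, subset_closure hx⟩
    · rintro (_ | t) hi
      · refine ⟨0, fun x hx y hy => ?_⟩
        have h0 : ∀ z ∈ closure (P.nbhd s)ᶜ, pou.χ s z * w z a = 0 := fun z hz => by
          have := congrFun (cutoff_eq_zero_of_mem_closure_compl pou hs hw a hz) a
          simpa [cutoff] using this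
        simp only [h0 x hx, h0 y hy, edist_self, zero_le]
      · have ht : t ∈ I := by simpa using hi
        obtain ⟨htf, hts⟩ := Finset.mem_filter.1 ht
        obtain ⟨L, hL⟩ := pou.lipschitz s hs.isNodeOrEdge
        obtain ⟨f, -, hf⟩ := hw.2.1 t hts a
        obtain ⟨C, hC⟩ := exists_lipschitzOnWith_mvPolynomial f (isCompact_hull t)
        refine exists_lipschitzOnWith_mul (isCompact_hull t)
          ⟨L, hL.mono (P.fine.hull_subset_space htf)⟩ ⟨C, fun x hx y hy => ?_⟩
        have := hC hx hy
        beta_reduce at this ⊢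
        rwa [← hf x hx, ← hf y hy] at this
  obtain ⟨C, hC⟩ := key
  refine ⟨C, LipschitzWith.of_dist_le_mul fun x y => ?_⟩
  rw [dist_pi_le_iff (by positivity)]
  intro b
  by_cases hb : b = a
  · simpa [cutoff, hb] using hC.dist_le_mul x y
  · simp only [cutoff, hb, if_false, dist_self]; positivity

/-- It exchanges the perforated element for the full triangle, so that the boundaries of the
perforations never enter the divergence theorem. -/
lemma setIntegral_interior_block {K : Finset Plane} {F : Plane → ℝ}
    (hF : ∀ x ∈ interior (hull K), x ∉ P.block K → F x = 0) :
    ∫ x in hull K, F x = ∫ x in interior (P.block K), F x := by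
  rw [← setIntegral_congr_set (interior_hull_ae_eq K)]
  refine setIntegral_eq_of_subset_of_ae_sdiff_eq_zero
    isOpen_interior.measurableSet.nullMeasurableSet (interior_block_subset_hull K) ?_
  filter_upwards [ae_notMem_skeleton (P := P)] with x hsk hx
  exact hF x hx.1 fun h => hx.2 (mem_interior_block h hsk)

open Classical in
/-- The mean divergence of the cut-off field of an interior edge on an adjacent element is given by
its flux through the edge. -/
lemma setIntegral_divJ_cutoff (pou : P.PartitionOfUnity) {s : Finset Plane}
    (hs : P.IsInteriorEdge s) {w : VField} (hw : P.IsVh s w) (a : Fin 2)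
    {A B : Finset Plane → Plane} (hAB : ∀ s : Finset Plane, s.card = 2 → s = {A s, B s})
    {K : Finset Plane} (hK : K ∈ P.coarse.tri) (hsK : s ⊆ K) {κ : Finset Plane → ℝ}
    (hκ : ∀ (φ : VField) (C : NNReal), LipschitzWith C φ → ∫ x in hull K, divJ (jet φ) x =
        ∑ s ∈ K.powersetCard 2, κ s * segFlux (A s) (B s) φ) :
    ∫ x in interior (P.block K), divJ (jet (cutoff (pou.χ s) w a)) x =
      κ s * segFlux (A s) (B s) (cutoff (pou.χ s) w a) := by
  set g := cutoff (pou.χ s) w a with hg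
  obtain ⟨C, hC⟩ := exists_lipschitzWith_cutoff pou hs hw a
  have h1 := hκ g C hC
  -- The other two sides do not contain `s`, so the cut-off field is zero on them.
  rw [Finset.sum_eq_single s] at h1
  · rw [← h1, setIntegral_interior_block]
    intro x hx hnb
    have hev : ∀ᶠ y in nhds x, g y = 0 := by
      filter_upwards [isOpen_interior.mem_nhds hx, (isClosed_block K).isOpen_compl.mem_nhds hnb]
        with y hy hyb
      exact cutoff_eq_zero_of_notMem_nbhd hw a fun h => hyb (mem_block_of_mem_nbhd hK hy h).2
    rw [divJ_jet, partialD_eq_zero_of_eventuallyEq, partialD_eq_zero_of_eventuallyEq, add_zero]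
    · filter_upwards [hev] with y hy using by rw [hy]; rfl
    · filter_upwards [hev] with y hy using by rw [hy]; rfl
  · intro s' hs' hne
    obtain ⟨hs'K, hs'2⟩ := Finset.mem_powersetCard.1 hs'
    have hnot : ¬ s ⊆ s' := fun h =>
      hne (Finset.eq_of_subset_of_card_le h (by rw [hs'2, hs.2.1])).symm
    have hface : s' ∈ P.coarse.faces :=
      P.coarse.down_closed (P.coarse.mem_tri.1 hK).1 hs'K (Finset.card_pos.1 (by omega))
    have hz : segFlux (A s') (B s') g = 0 := by
      unfold segFlux
      refine (intervalIntegral.integral_congr fun r hr => ?_).trans intervalIntegral.integral_zero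
      rw [Set.uIcc_of_le zero_le_one] at hr
      have hmem : A s' + r • (B s' - A s') ∈ hull s' := by
        rw [hAB s' hs'2, hull_pair, segment_eq_image', ← hAB s' hs'2]
        exact ⟨r, hr, rfl⟩
      have h0 : g (A s' + r • (B s' - A s')) = 0 :=
        cutoff_eq_zero_of_mem_face pou hs.isNodeOrEdge hw a hface hnot hmem
      simp [h0]
    rw [hz, mul_zero]
  · intro hnot
    exact absurd (Finset.mem_powersetCard.2 ⟨hsK, hs.2.1⟩) hnot

/-! ## Bounds for the offline basis functions -/

lemma ae_domain_mem_interior_block :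
    ∀ᵐ x ∂volume.restrict P.domain, ∃ K ∈ P.coarse.tri, x ∈ interior (P.block K) := by
  rw [Measure.restrict_congr_set domain_ae_eq]
  filter_upwards [ae_restrict_mem
    (P.coarse.tri.measurableSet_biUnion fun K _ => isOpen_interior.measurableSet)] with x hx
  simpa using hx

lemma memLp_domain {f : Plane → ℝ}
    (h : ∀ K ∈ P.coarse.tri, MemLp f 2 (volume.restrict (interior (P.block K)))) :
    MemLp f 2 (volume.restrict P.domain) := by
  have hm : ∀ K : Finset Plane, MeasurableSet (interior (P.block K)) := fun K =>
    isOpen_interior.measurableSet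
  have h1 : MemLp (fun x => ∑ K ∈ P.coarse.tri, (interior (P.block K)).indicator f x) 2 volume :=
    memLp_finsetSum _ fun K hK => (memLp_indicator_iff_restrict (hm K)).2 (h K hK)
  refine (memLp_congr_ae ?_).1 (h1.restrict P.domain)
  filter_upwards [ae_domain_mem_interior_block (P := P)] with x hx
  obtain ⟨K, hK, hxK⟩ := hx
  rw [Finset.sum_eq_single_of_mem K hK, Set.indicator_of_mem hxK]
  intro K' hK' hne
  refine Set.indicator_of_notMem (fun hx' => ?_) _
  exact Set.disjoint_left.1 (pairwiseDisjoint_interior_block hK' hK hne) hx' hxK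

lemma jetL2_domain {J : Jet} (h : ∀ K ∈ P.coarse.tri, JetL2 (interior (P.block K)) J) :
    JetL2 P.domain J :=
  ⟨fun a => memLp_domain fun K hK => (h K hK).1 a,
    fun a b => memLp_domain fun K hK => (h K hK).2 a b⟩

lemma isBounded_interior_block (K : Finset Plane) : Bornology.IsBounded (interior (P.block K)) :=
  (isCompact_block K).isBounded.subset interior_subset

lemma notMem_nbhd_of_not_subset {s K : Finset Plane} (hK : K ∈ P.coarse.tri) (hs : ¬ s ⊆ K)
    {x : Plane} (hx : x ∈ interior (P.block K)) : x ∉ P.nbhd s := fun h =>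
  hs (mem_block_of_mem_nbhd hK (interior_block_subset_hull K hx) h).1

lemma IsStokesExtension.jetL2 {s : Finset Plane} {g : VField} {J : Jet}
    (hJ : P.IsStokesExtension s g J) {C : NNReal} (hg : LipschitzWith C g) :
    JetL2 P.domain J := by
  refine jetL2_domain fun K hK => ?_
  by_cases hs : s ⊆ K
  · have h1 := (hJ.2 K hK hs).1.1.1
    have h2 := h1.add (jetL2_jet_of_lipschitz hg (isBounded_interior_block K))
    rwa [sub_add_cancel] at h2
  · refine JetL2.zero.congr ?_
    filter_upwards [ae_restrict_mem isOpen_interior.measurableSet] with x hx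
    have := hJ.1 x (notMem_nbhd_of_not_subset hK hs hx)
    exact ⟨this.1.symm, this.2.symm⟩

/-- The two fields differ by an element of `H¹₀` of the perforated element, which has zero mean
divergence. -/
lemma IsStokesExtension.setIntegral_divJ {s : Finset Plane} {g : VField} {J : Jet}
    (hJ : P.IsStokesExtension s g J) {C : NNReal} (hg : LipschitzWith C g) {K : Finset Plane}
    (hK : K ∈ P.coarse.tri) (hs : s ⊆ K) :
    ∫ x in interior (P.block K), divJ J x = ∫ x in interior (P.block K), divJ (jet g) x := by
  have hb := isBounded_interior_block (P := P) K
  have hfin : IsFiniteMeasure (volume.restrict (interior (P.block K))) :=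
    isFiniteMeasure_restrict.2 hb.measure_lt_top.ne
  have h0 := setIntegral_divJ_eq_zero_of_mem_H10 hb (hJ.2 K hK hs).1.1
  have hL := (hJ.jetL2 hg).mono_set (interior_block_subset_domain K)
  have hLg := jetL2_jet_of_lipschitz hg hb
  simp only [divJ_sub] at h0
  rw [integral_sub (hL.memLp_divJ.integrable (by norm_num))
    (hLg.memLp_divJ.integrable (by norm_num))] at h0
  linarith

/-- The classical derivative has the default value zero where it does not exist, so additivity is
asserted only at points of differentiability. -/
lemma jet_add_of_differentiableAt {u v : VField} {x : Plane}
    (hu : ∀ a, DifferentiableAt ℝ (fun y => u y a) x)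
    (hv : ∀ a, DifferentiableAt ℝ (fun y => v y a) x) :
    (jet (u + v)).2 x = (jet u).2 x + (jet v).2 x := by
  ext a b
  have := (hu a).hasFDerivAt.add (hv a).hasFDerivAt
  have h2 : fderiv ℝ (fun y => (u + v) y a) x = _ := HasFDerivAt.fderiv this
  simp only [jet, grad, partialD, Pi.add_apply]
  simp only [Pi.add_apply] at h2
  rw [h2]; rfl

lemma jet_congr_of_eventuallyEq {u v : VField} {x : Plane} (h : u =ᶠ[nhds x] v) :
    (jet u).1 x = (jet v).1 x ∧ (jet u).2 x = (jet v).2 x := by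
  refine ⟨h.self_of_nhds, ?_⟩
  ext a b
  have : (fun y => u y a) =ᶠ[nhds x] fun y => v y a := by
    filter_upwards [h] with y hy using by rw [hy]
  simp only [jet, grad, partialD]
  rw [this.fderiv_eq]

lemma sqJ_congr {J J' : Jet} {x : Plane} (h1 : J.1 x = J'.1 x) (h2 : J.2 x = J'.2 x) :
    sqJ J x = sqJ J' x := by
  simp only [sqJ, h1, h2]

open Classical in
/-- A Stokes extension is approximated in `H¹` by Lipschitz fields supported in the neighborhood. -/
lemma IsStokesExtension.exists_lipschitz_approx {s : Finset Plane} {g : VField} {J : Jet}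
    (hJ : P.IsStokesExtension s g J) {C : NNReal} (hg : LipschitzWith C g)
    (hg0 : ∀ x, x ∉ P.nbhd s → g x = 0) {ε : ℝ} (hε : 0 < ε) :
    ∃ (F : VField) (D : NNReal), LipschitzWith D F ∧ (∀ x, x ∉ P.nbhd s → F x = 0) ∧
      ∫ x in P.domain, sqJ (J - jet F) x ≤ ε := by
  set N : ℝ := (P.coarse.tri.card : ℝ) with hN
  -- An error `δ` on each of the `N` elements adds up to at most `ε`; the added one avoids division
  -- by zero.
  set δ : ℝ := ε / (N + 1) with hδ
  have hδ0 : 0 < δ := by positivity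
  have hex : ∀ K : Finset Plane, ∃ φ : VField, (K ∈ P.coarse.tri → s ⊆ K →
      IsTest (interior (P.block K)) φ ∧
      ∫ x in interior (P.block K), sqJ (J - jet g - jet φ) x ≤ δ) := by
    intro K
    by_cases hK : K ∈ P.coarse.tri ∧ s ⊆ K
    · obtain ⟨hL, φ, hφ, hlim⟩ := (hJ.2 K hK.1 hK.2).1.1
      have h2 := hlim.pow 2
      rw [zero_pow two_ne_zero] at h2
      obtain ⟨n, hn⟩ := (h2.eventually (gt_mem_nhds hδ0)).exists
      refine ⟨φ n, fun _ _ => ⟨hφ n, ?_⟩⟩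
      obtain ⟨D, hD⟩ := (hφ n).exists_lipschitzWith
      rw [← (hL.sub (jetL2_jet_of_lipschitz hD (isBounded_interior_block K))).h1norm_sq]
      exact hn.le
    · exact ⟨0, fun h1 h2 => absurd ⟨h1, h2⟩ hK⟩
  choose φ hφ using hex
  set S := P.coarse.tri.filter fun K => s ⊆ K with hS
  have hSmem : ∀ K ∈ S, IsTest (interior (P.block K)) (φ K) := fun K hK =>
    (hφ K (Finset.mem_filter.1 hK).1 (Finset.mem_filter.1 hK).2).1
  have hlip : ∃ D, LipschitzWith D (∑ K ∈ S, φ K) :=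
    Finset.sum_induction φ (fun f => ∃ D, LipschitzWith D f)
      (fun _ _ ⟨D, hD⟩ ⟨E, hE⟩ => ⟨D + E, hD.add hE⟩) ⟨0, LipschitzWith.const 0⟩
      fun K hK => (hSmem K hK).exists_lipschitzWith
  obtain ⟨D, hD⟩ := hlip
  have hF0 : ∀ x, x ∉ P.nbhd s → (g + ∑ K ∈ S, φ K) x = 0 := by
    intro x hx
    rw [Pi.add_apply, hg0 x hx, zero_add, Finset.sum_apply]
    refine Finset.sum_eq_zero fun K hK => ?_
    obtain ⟨hK1, hK2⟩ := Finset.mem_filter.1 hK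
    by_contra hne
    have hxt : x ∈ tsupport (φ K) := subset_tsupport _ hne
    exact hx (block_subset_nbhd hK1 hK2 (interior_subset ((hSmem K hK).2.2 hxt)))
  refine ⟨g + ∑ K ∈ S, φ K, C + D, hg.add hD, hF0, ?_⟩
  have hFL : JetL2 P.domain (jet (g + ∑ K ∈ S, φ K)) :=
    jetL2_jet_of_lipschitz (hg.add hD) isBounded_domain
  rw [setIntegral_domain_eq_sum ((hJ.jetL2 hg).sub hFL).integrable_sqJ]
  have hterm : ∀ K ∈ P.coarse.tri,
      ∫ x in interior (P.block K), sqJ (J - jet (g + ∑ K ∈ S, φ K)) x ≤ δ := by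
    intro K hK
    by_cases hsK : s ⊆ K
    · have hKS : K ∈ S := Finset.mem_filter.2 ⟨hK, hsK⟩
      refine le_trans (le_of_eq (setIntegral_congr_ae isOpen_interior.measurableSet ?_))
        (hφ K hK hsK).2
      filter_upwards [(LipschitzWith.component hg 0).ae_differentiableAt,
        (LipschitzWith.component hg 1).ae_differentiableAt] with x d0 d1 hx
      -- The correctors have supports inside the interiors of their own blocks, so only `φ K` is
      -- seen near a point of block `K`. Continuity across the elements comes from `g`.
      have hev : g + ∑ K ∈ S, φ K =ᶠ[nhds x] g + φ K := by
        filter_upwards [isOpen_interior.mem_nhds hx] with y hy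
        rw [Pi.add_apply, Pi.add_apply, Finset.sum_apply, Finset.sum_eq_single_of_mem K hKS]
        intro K' hK' hne
        by_contra hne0
        have hyt : y ∈ tsupport (φ K') := subset_tsupport _ hne0
        exact Set.disjoint_left.1 (pairwiseDisjoint_interior_block
          (Finset.mem_filter.1 hK').1 hK hne) ((hSmem K' hK').2.2 hyt) hy
      obtain ⟨e1, e2⟩ := jet_congr_of_eventuallyEq hev
      have hdφ : ∀ a, DifferentiableAt ℝ (fun y => φ K y a) x := fun a =>
        (contDiff_pi.1 (hSmem K hKS).1 a).differentiable (by simp) x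
      have e3 := jet_add_of_differentiableAt (u := g) (v := φ K) (x := x)
        (fun a => by fin_cases a; exacts [d0, d1]) hdφ
      apply sqJ_congr
      · simp only [Prod.fst_sub, Pi.sub_apply, e1]
        simp only [jet, Pi.add_apply]
        abel
      · simp only [Prod.snd_sub, Pi.sub_apply, e2, e3]
        abel
    · refine le_trans (le_of_eq ?_) hδ0.le
      refine setIntegral_eq_zero_of_forall_eq_zero fun x hx => ?_
      have hev : g + ∑ K ∈ S, φ K =ᶠ[nhds x] 0 := by
        filter_upwards [isOpen_interior.mem_nhds hx] with y hy
        exact hF0 y (notMem_nbhd_of_not_subset hK hsK hy)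
      obtain ⟨e1, e2⟩ := jet_congr_of_eventuallyEq hev
      have hJ0 := hJ.1 x (notMem_nbhd_of_not_subset hK hsK hx)
      have : (jet 0).2 x = 0 := by
        ext a b
        simp only [jet, grad]
        exact partialD_eq_zero_of_eventuallyEq (Filter.Eventually.of_forall fun _ => rfl) b
      rw [sqJ_congr (J' := 0)]
      · simp [sqJ]
      · simp only [Prod.fst_sub, Pi.sub_apply, e1, hJ0.1]; simp [jet]
      · simp only [Prod.snd_sub, Pi.sub_apply, e2, hJ0.2, this]; simp
  refine (Finset.sum_le_card_nsmul _ _ _ hterm).trans ?_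
  rw [nsmul_eq_mul, ← hN, hδ, mul_div_assoc', div_le_iff₀ (by positivity)]
  nlinarith

/-! ### The Poincaré inequality on coarse neighborhoods and control by the energy -/

lemma closedDomain_ae_eq : P.domain =ᵐ[volume] P.closedDomain := by
  filter_upwards [ae_notMem_skeleton (P := P)] with x hx
  change (x ∈ P.domain) = (x ∈ P.closedDomain)
  refine propext ⟨fun h => domain_subset h, fun h => ?_⟩
  obtain ⟨K, -, hxK⟩ := exists_mem_block h
  exact interior_block_subset_domain K (mem_interior_block hxK hx)

lemma setIntegral_domain_of_eq_zero {s : Finset Plane} {F : Plane → ℝ}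
    (hF : ∀ x, x ∉ P.nbhd s → F x = 0) :
    ∫ x in P.domain, F x = ∫ x in P.nbhd s, F x := by
  rw [setIntegral_congr_set closedDomain_ae_eq]
  exact setIntegral_eq_of_subset_of_forall_sdiff_eq_zero
    isCompact_closedDomain.measurableSet (nbhd_subset_closedDomain s) fun x hx => hF x hx.2

/-- The Poincaré inequality for Lipschitz fields supported in a coarse neighborhood. -/
lemma setIntegral_sq_le_of_support_nbhd {s : Finset Plane} (hs : s.Nonempty) {F : VField}
    {D : NNReal} (hD : LipschitzWith D F) (hF : ∀ x, x ∉ P.nbhd s → F x = 0) :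
    ∫ x in P.domain, ∑ a, F x a ^ 2 ≤
      4 * ∫ x in P.domain, ∑ a, ∑ b, (jet F).2 x a b ^ 2 := by
  obtain ⟨p, hp⟩ := hs
  have hL : JetL2 P.domain (jet F) := jetL2_jet_of_lipschitz hD isBounded_domain
  have hcs : HasCompactSupport F := HasCompactSupport.intro (isCompact_nbhd s) hF
  -- Every element of the neighborhood has the vertex `p` and diameter less than one.
  have hstrip : ∀ x ∈ P.nbhd s, |x 0 - p 0| ≤ 1 := by
    intro x hx
    obtain ⟨K, hK, hsK, hxK⟩ := mem_nbhd.1 hx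
    have h1 := Metric.dist_le_diam_of_mem (isCompact_hull K).isBounded (block_subset_hull K hxK)
      (subset_convexHull ℝ _ (Finset.mem_coe.2 (hsK hp)))
    have h2 := h1.trans (P.meshSize_lt_one K hK).le
    have h3 := PiLp.norm_apply_le (x - p) 0
    rw [← dist_eq_norm] at h3
    exact h3.trans h2
  have hcomp : ∀ a, ∫ x in P.domain, F x a ^ 2 ≤
      4 * ∫ x in P.domain, (jet F).2 x a 0 ^ 2 := by
    intro a
    have h1 := integral_sq_le_integral_partialD_sq (LipschitzWith.component hD a)
      (hasCompactSupport_component hcs a) (c := p 0) fun x hx => hstrip x (by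
        by_contra hne
        exact hx (by rw [hF x hne]; rfl))
    have z1 : ∀ x, x ∉ P.nbhd s → F x a ^ 2 = 0 := fun x hx => by simp [hF x hx]
    have z2 : ∀ x, x ∉ P.nbhd s → partialD (fun y => F y a) 0 x ^ 2 = 0 := fun x hx => by
      rw [partialD_eq_zero_of_eventuallyEq, zero_pow two_ne_zero]
      filter_upwards [(isClosed_nbhd s).isOpen_compl.mem_nhds hx] with y hy
      rw [hF y hy]; rfl
    rw [← setIntegral_eq_integral_of_forall_compl_eq_zero z1,
      ← setIntegral_eq_integral_of_forall_compl_eq_zero z2, ← setIntegral_domain_of_eq_zero z1,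
      ← setIntegral_domain_of_eq_zero z2] at h1
    exact h1
  have hval : ∫ x in P.domain, ∑ a, F x a ^ 2 = ∑ a, ∫ x in P.domain, F x a ^ 2 :=
    integral_finsetSum _ fun a _ => (hL.1 a).integrable_sq
  have hgrad : ∑ a, ∫ x in P.domain, (jet F).2 x a 0 ^ 2 ≤
      ∫ x in P.domain, ∑ a, ∑ b, (jet F).2 x a b ^ 2 := by
    rw [← integral_finsetSum _ fun a _ => (hL.2 a 0).integrable_sq]
    refine integral_mono (integrable_finsetSum _ fun a _ => (hL.2 a 0).integrable_sq)
      hL.integrable_grad fun x => ?_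
    exact Finset.sum_le_sum fun a _ =>
      Finset.single_le_sum (f := fun b => (jet F).2 x a b ^ 2) (fun b _ => sq_nonneg _)
        (Finset.mem_univ 0)
  rw [hval]
  refine (Finset.sum_le_sum fun a _ => hcomp a).trans ?_
  rw [← Finset.mul_sum]
  linarith

/-- The `H¹` norm of a Stokes extension is bounded by its energy. -/
lemma IsStokesExtension.integral_sqJ_le {s : Finset Plane} (hs : s.Nonempty) {g : VField} {J : Jet}
    (hJ : P.IsStokesExtension s g J) {C : NNReal} (hg : LipschitzWith C g)
    (hg0 : ∀ x, x ∉ P.nbhd s → g x = 0) :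
    ∫ x in P.domain, sqJ J x ≤ 17 * energy (P.nbhd s) J := by
  have hL := hJ.jetL2 hg
  have hen : energy P.domain J = energy (P.nbhd s) J :=
    setIntegral_domain_of_eq_zero fun x hx => by simp [(hJ.1 x hx).2]
  rw [hL.integral_sqJ, ← hen]
  refine le_of_forall_pos_le_add fun δ hδ => ?_
  -- With approximation error `e` and energy `E`, the squared `L²` norm of the values of `J` is at
  -- most `2·4·(2E + 2e) + 2e = 16E + 18e`. Hence `e ≤ δ/18`, and `16 + 1 = 17` once the energy
  -- itself is added.
  obtain ⟨F, D, hD, hF0, hF⟩ := hJ.exists_lipschitz_approx hg hg0 (show 0 < δ / 18 by positivity)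
  have hLF : JetL2 P.domain (jet F) := jetL2_jet_of_lipschitz hD isBounded_domain
  have hLFv : IntegrableOn (fun x => ∑ a, F x a ^ 2) P.domain := hLF.integrable_val
  have hLd := hL.sub hLF
  have hpoinc := setIntegral_sq_le_of_support_nbhd hs hD hF0
  have key : ∀ s t : ℝ, s ^ 2 ≤ 2 * t ^ 2 + 2 * (s - t) ^ 2 := fun s t => by
    nlinarith [sq_nonneg (s - 2 * t)]
  have key' : ∀ s t : ℝ, t ^ 2 ≤ 2 * s ^ 2 + 2 * (s - t) ^ 2 := fun s t => by
    nlinarith [sq_nonneg (t - 2 * s)]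
  have b1 : ∫ x in P.domain, ∑ a, J.1 x a ^ 2 ≤
      2 * (∫ x in P.domain, ∑ a, F x a ^ 2) + 2 * ∫ x in P.domain, sqJ (J - jet F) x := by
    rw [← integral_const_mul, ← integral_const_mul,
      ← integral_add (hLFv.const_mul 2) (hLd.integrable_sqJ.const_mul 2)]
    refine integral_mono hL.integrable_val
      ((hLFv.const_mul 2).add (hLd.integrable_sqJ.const_mul 2)) fun x => ?_
    simp only [sqJ, Fin.sum_univ_two, Prod.fst_sub, Prod.snd_sub, Pi.sub_apply, jet]
    have h1 := key (J.1 x 0) (F x 0)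
    have h2 := key (J.1 x 1) (F x 1)
    have h3 : 0 ≤ (J.2 x 0 0 - grad F x 0 0) ^ 2 + (J.2 x 0 1 - grad F x 0 1) ^ 2 +
      ((J.2 x 1 0 - grad F x 1 0) ^ 2 + (J.2 x 1 1 - grad F x 1 1) ^ 2) := by positivity
    linarith
  have b2 : ∫ x in P.domain, ∑ a, ∑ b, (jet F).2 x a b ^ 2 ≤
      2 * energy P.domain J + 2 * ∫ x in P.domain, sqJ (J - jet F) x := by
    rw [energy, ← integral_const_mul, ← integral_const_mul,
      ← integral_add (hL.integrable_grad.const_mul 2) (hLd.integrable_sqJ.const_mul 2)]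
    refine integral_mono hLF.integrable_grad
      ((hL.integrable_grad.const_mul 2).add (hLd.integrable_sqJ.const_mul 2)) fun x => ?_
    simp only [sqJ, Fin.sum_univ_two, Prod.fst_sub, Prod.snd_sub, Pi.sub_apply, jet]
    have h1 := key' (J.2 x 0 0) (grad F x 0 0)
    have h2 := key' (J.2 x 0 1) (grad F x 0 1)
    have h3 := key' (J.2 x 1 0) (grad F x 1 0)
    have h4 := key' (J.2 x 1 1) (grad F x 1 1)
    have h5 : 0 ≤ (J.1 x 0 - F x 0) ^ 2 + (J.1 x 1 - F x 1) ^ 2 := by positivity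
    linarith
  linarith

/-! ## The discrete inf-sup condition -/

/-- The support of a test field stays in the domain, and inside `K` the domain is covered by the
block of `K` alone. -/
lemma eq_zero_of_isTest_domain {φ : VField} (hφ : IsTest P.domain φ) {K : Finset Plane}
    (hK : K ∈ P.coarse.tri) {x : Plane} (hx : x ∈ interior (hull K)) (hn : x ∉ P.block K) :
    (jet φ).1 x = 0 ∧ (jet φ).2 x = 0 := by
  refine jet_eq_zero_of_notMem_tsupport fun ht => ?_
  obtain ⟨K', hK', hxK'⟩ := exists_mem_block (domain_subset (hφ.2.2 ht))
  obtain rfl := Triangulation.eq_of_mem_interior_hull hK hK' hx (block_subset_hull K' hxK')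
  exact hn hxK'

open Classical in
/-- The interior coarse edges. -/
def intEdges (P : PerforatedMesh) : Finset (Finset Plane) :=
  P.coarse.finite_faces.toFinset.filter P.IsInteriorEdge

lemma mem_intEdges {s : Finset Plane} : s ∈ P.intEdges ↔ P.IsInteriorEdge s := by
  simp only [intEdges, Finset.mem_filter, Set.Finite.mem_toFinset, and_iff_right_iff_imp]
  exact fun h => h.1

open Classical in
lemma card_filter_intEdges_le {K : Finset Plane} (hK : K ∈ P.coarse.tri) :
    (P.intEdges.filter fun s => s ⊆ K).card ≤ 3 := by
  have hsub : (P.intEdges.filter fun s => s ⊆ K) ⊆ K.powersetCard 2 := by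
    intro s hs
    obtain ⟨h1, h2⟩ := Finset.mem_filter.1 hs
    exact Finset.mem_powersetCard.2 ⟨h2, (mem_intEdges.1 h1).2.1⟩
  refine (Finset.card_le_card hsub).trans ?_
  rw [Finset.card_powersetCard, (P.coarse.mem_tri.1 hK).2]
  decide

lemma sqJ_sum_le {ι : Type*} (S : Finset ι) (c : ι → ℝ) (J : ι → Jet) (x : Plane) :
    sqJ (∑ i ∈ S, c i • J i) x ≤ S.card * ∑ i ∈ S, c i ^ 2 * sqJ (J i) x := by
  have h : ∀ f : ι → ℝ, (∑ i ∈ S, c i * f i) ^ 2 ≤ S.card * ∑ i ∈ S, c i ^ 2 * f i ^ 2 := by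
    intro f
    refine (sq_sum_le_card_mul_sum_sq).trans_eq ?_
    simp only [mul_pow]
  have e1 : ∀ a, (∑ i ∈ S, c i • J i).1 x a = ∑ i ∈ S, c i * (J i).1 x a := fun a => by
    simp [Prod.fst_sum, Finset.sum_apply]
  have e2 : ∀ a b, (∑ i ∈ S, c i • J i).2 x a b = ∑ i ∈ S, c i * (J i).2 x a b := fun a b => by
    simp [Prod.snd_sum, Finset.sum_apply]
  simp only [sqJ, e1, e2, Fin.sum_univ_two, mul_add, Finset.sum_add_distrib]
  have h0 := h fun i => (J i).1 x 0
  have h1 := h fun i => (J i).1 x 1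
  have h2 := h fun i => (J i).2 x 0 0
  have h3 := h fun i => (J i).2 x 0 1
  have h4 := h fun i => (J i).2 x 1 0
  have h5 := h fun i => (J i).2 x 1 1
  linarith

open Classical in
/-- At most three of the basis functions of edges overlap. -/
lemma integral_sqJ_sum_le {c : Finset Plane → ℝ} {J : Finset Plane → Jet}
    (hL : ∀ s ∈ P.intEdges, JetL2 P.domain (J s))
    (hJ : ∀ s ∈ P.intEdges, ∀ x, x ∉ P.nbhd s → (J s).1 x = 0 ∧ (J s).2 x = 0) :
    ∫ x in P.domain, sqJ (∑ s ∈ P.intEdges, c s • J s) x ≤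
      3 * ∑ s ∈ P.intEdges, c s ^ 2 * ∫ x in P.domain, sqJ (J s) x := by
  have hi : ∀ s ∈ P.intEdges, Integrable (fun x => c s ^ 2 * sqJ (J s) x)
      (volume.restrict P.domain) := fun s hs => (hL s hs).integrable_sqJ.const_mul _
  simp only [← integral_const_mul (μ := volume.restrict P.domain) (c _ ^ 2)]
  rw [← integral_finsetSum _ hi, ← integral_const_mul]
  refine integral_mono_ae (JetL2.sum fun s hs => (hL s hs).const_smul (c s)).integrable_sqJ
    ((integrable_finsetSum _ hi).const_mul 3) ?_
  filter_upwards [ae_domain_mem_interior_block (P := P)] with x hx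
  obtain ⟨K, hK, hxK⟩ := hx
  -- At a point of the element `K` only the edges of `K` contribute, at most three, and
  -- Cauchy–Schwarz costs their number.
  have hz : ∀ s ∈ P.intEdges, ¬ s ⊆ K → (J s).1 x = 0 ∧ (J s).2 x = 0 := fun s hs hsK =>
    hJ s hs x (notMem_nbhd_of_not_subset hK hsK hxK)
  have e : sqJ (∑ s ∈ P.intEdges, c s • J s) x =
      sqJ (∑ s ∈ P.intEdges.filter (fun s => s ⊆ K), c s • J s) x := by
    apply sqJ_congr
    · rw [Prod.fst_sum, Prod.fst_sum, Finset.sum_apply, Finset.sum_apply,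
        Finset.sum_filter_of_ne]
      intro s hs hne
      by_contra hsK
      exact hne (by simp [(hz s hs hsK).1])
    · rw [Prod.snd_sum, Prod.snd_sum, Finset.sum_apply, Finset.sum_apply,
        Finset.sum_filter_of_ne]
      intro s hs hne
      by_contra hsK
      exact hne (by simp [(hz s hs hsK).2])
  rw [e]
  refine (sqJ_sum_le _ _ _ _).trans ?_
  have hc : ((P.intEdges.filter fun s => s ⊆ K).card : ℝ) ≤ 3 := by
    exact_mod_cast card_filter_intEdges_le hK
  have hnn : ∀ s ∈ P.intEdges, 0 ≤ c s ^ 2 * sqJ (J s) x := fun s _ =>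
    mul_nonneg (sq_nonneg _) (sqJ_nonneg _ _)
  refine mul_le_mul hc ?_ (Finset.sum_nonneg fun s hs => hnn s (Finset.mem_filter.1 hs).1)
    (by norm_num)
  exact Finset.sum_le_sum_of_subset_of_nonneg (Finset.filter_subset _ _) fun s hs _ => hnn s hs

open Classical in
/-- The fluxes of a test field through the interior edges are bounded by its `H¹` norm. -/
lemma sum_segFlux_sq_le {σ : ℝ} (hσ : P.ShapeRegular σ) {φ : VField} (hφ : IsTest P.domain φ)
    {A B : Finset Plane → Plane} (hAB : ∀ s : Finset Plane, s.card = 2 → s = {A s, B s}) :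
    ∑ s ∈ P.intEdges, segFlux (A s) (B s) φ ^ 2 ≤
      6 * |σ| * ∫ x in P.domain, sqJ (jet φ) x := by
  obtain ⟨C, hC⟩ := hφ.exists_lipschitzWith
  have hL : JetL2 P.domain (jet φ) := jetL2_jet_of_lipschitz hC isBounded_domain
  set S : Finset Plane → ℝ := fun K => ∫ x in interior (P.block K), sqJ (jet φ) x with hS
  have hS0 : ∀ K, 0 ≤ S K := fun K => integral_nonneg fun x => sqJ_nonneg _ x
  have hone : ∀ s ∈ P.intEdges, ∀ K ∈ P.coarse.tri, s ⊆ K →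
      segFlux (A s) (B s) φ ^ 2 ≤ 2 * |σ| * S K := by
    intro s hs K hK hsK
    have h2 := (mem_intEdges.1 hs).2.1
    obtain ⟨r, hKe, hD⟩ := Triangulation.exists_third_vertex hK hsK (hAB s h2) h2
    -- The opposite vertex is listed first, as the flux estimate concerns the side facing the first
    -- vertex.
    have hrot : hull K = convexHull ℝ ({r, A s, B s} : Set Plane) := by
      rw [hKe, hull_triple]
      congr 1
      ext x
      simp only [Set.mem_insert_iff, Set.mem_singleton_iff]
      tauto
    have hSK : S K = ∫ x in convexHull ℝ ({r, A s, B s} : Set Plane), sqJ (jet φ) x := by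
      rw [← hrot]
      refine (setIntegral_interior_block fun x hx hn => ?_).symm
      obtain ⟨h1, h2⟩ := eq_zero_of_isTest_domain hφ hK hx hn
      simp [sqJ, h1, h2]
    rw [hSK]
    have hD' : cross (A s - r) (B s - r) ≠ 0 := by rwa [cross_rotate, cross_rotate]
    refine segFlux_sq_le (hφ.1.of_le (by simp)) hφ.2.1 hD' (P.meshSize_lt_one K hK).le ?_ ?_
    · rw [← hrot]
      exact fun x hx y hy => Metric.dist_le_diam_of_mem (isCompact_hull K).isBounded hx hy
    · rw [← hrot]
      exact (hσ K hK).trans (mul_le_mul_of_nonneg_right (le_abs_self σ) measureReal_nonneg)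
  calc ∑ s ∈ P.intEdges, segFlux (A s) (B s) φ ^ 2
      ≤ ∑ s ∈ P.intEdges, ∑ K ∈ P.coarse.tri, if s ⊆ K then 2 * |σ| * S K else 0 := by
        refine Finset.sum_le_sum fun s hs => ?_
        -- One adjacent triangle suffices for each edge. After the sums are exchanged a triangle is
        -- charged at most three times, so `2|σ|` becomes `6|σ|`.
        obtain ⟨K, hK, hsK, hK3⟩ := P.coarse.pure_two s (mem_intEdges.1 hs).1
        have hKt := P.coarse.mem_tri.2 ⟨hK, hK3⟩
        refine (hone s hs K hKt hsK).trans ?_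
        have := Finset.single_le_sum (f := fun K => if s ⊆ K then 2 * |σ| * S K else 0)
          (fun K' _ => by
            have := hS0 K'
            beta_reduce
            split_ifs <;> positivity) hKt
        simpa [hsK] using this
    _ = ∑ K ∈ P.coarse.tri, ∑ s ∈ P.intEdges, if s ⊆ K then 2 * |σ| * S K else 0 :=
        Finset.sum_comm
    _ ≤ ∑ K ∈ P.coarse.tri, 6 * |σ| * S K := by
        refine Finset.sum_le_sum fun K hK => ?_
        rw [← Finset.sum_filter, Finset.sum_const, nsmul_eq_mul]
        have hc : ((P.intEdges.filter fun s => s ⊆ K).card : ℝ) ≤ 3 := by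
          exact_mod_cast card_filter_intEdges_le hK
        have h0 : 0 ≤ 2 * |σ| * S K := by have := hS0 K; positivity
        nlinarith
    _ = 6 * |σ| * ∫ x in P.domain, sqJ (jet φ) x := by
        rw [← Finset.mul_sum, setIntegral_domain_eq_sum hL.integrable_sqJ]

lemma memLp_of_mem_Qoff {p : Plane → ℝ} (hp : p ∈ P.Qoff) :
    MemLp p 2 (volume.restrict P.domain) := by
  refine memLp_domain fun K hK => ?_
  obtain ⟨c, hc⟩ := hp.1 K hK
  have hfin : IsFiniteMeasure (volume.restrict (interior (P.block K))) :=
    isFiniteMeasure_restrict.2 (isBounded_interior_block K).measure_lt_top.ne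
  refine (memLp_congr_ae ?_).2 (memLp_const c)
  filter_upwards [ae_restrict_mem isOpen_interior.measurableSet] with x hx using hc x hx

open Classical in
lemma exists_edge_ends : ∃ A B : Finset Plane → Plane,
    ∀ s : Finset Plane, s.card = 2 → s = {A s, B s} := by
  have : ∀ s : Finset Plane, ∃ a b, s.card = 2 → s = {a, b} := by
    intro s
    by_cases h : s.card = 2
    · obtain ⟨a, b, -, hab⟩ := Finset.card_eq_two.1 h
      exact ⟨a, b, fun _ => hab⟩
    · exact ⟨0, 0, fun h' => absurd h' h⟩
  choose A B h using this
  exact ⟨A, B, h⟩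

open Classical in
/-- For every test field there is an offline field with the same divergence in the mean on each
coarse element, whose `H¹` norm is bounded by that of the test field. -/
lemma OfflineData.exists_mem_Voff (O : P.OfflineData) {Cmax σ : ℝ} (hσ : P.ShapeRegular σ)
    (hO : O.FluxCondition Cmax) {φ : VField} (hφ : IsTest P.domain φ) :
    ∃ u ∈ O.Voff, JetL2 P.domain u ∧
      h1norm P.domain u ^ 2 ≤ 306 * |Cmax| * |σ| * h1norm P.domain (jet φ) ^ 2 ∧
      ∀ p ∈ P.Qoff, ∫ x in P.domain, divJ u x * p x = ∫ x in P.domain, divJ (jet φ) x * p x := by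
  obtain ⟨A, B, hAB⟩ := exists_edge_ends
  have hflux : ∀ s, ∃ (k : ℕ) (a : Fin 2), P.IsInteriorEdge s → k < O.M s ∧
      O.edgeFlux s k a (A s) (B s) ≠ 0 ∧
      energy (P.nbhd s) (O.basis s k a) ≤ Cmax * O.edgeFlux s k a (A s) (B s) ^ 2 := by
    intro s
    by_cases hs : P.IsInteriorEdge s
    · have hset : (s : Set Plane) = {A s, B s} := by
        conv_lhs => rw [hAB s hs.2.1]
        simp
      obtain ⟨k, hk, a, h1, h2⟩ := hO s (A s) (B s) hs hset
      exact ⟨k, a, fun _ => ⟨hk, h1, h2⟩⟩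
    · exact ⟨0, 0, fun h => absurd h hs⟩
  choose k a hka using hflux
  set g : Finset Plane → VField := fun s => cutoff (O.pou.χ s) (O.eigfun s (k s)) (a s) with hg
  set J : Finset Plane → Jet := fun s => O.basis s (k s) (a s) with hJdef
  set f : Finset Plane → ℝ := fun s => segFlux (A s) (B s) (g s) with hf
  have hVh : ∀ s ∈ P.intEdges, P.IsVh s (O.eigfun s (k s)) := fun s hs =>
    O.isVh_eigfun (mem_intEdges.1 hs).isNodeOrEdge (hka s (mem_intEdges.1 hs)).1
  have hlip : ∀ s ∈ P.intEdges, ∃ C, LipschitzWith C (g s) := fun s hs =>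
    exists_lipschitzWith_cutoff O.pou (mem_intEdges.1 hs) (hVh s hs) (a s)
  have hJ : ∀ s ∈ P.intEdges, P.IsStokesExtension s (g s) (J s) := fun s hs =>
    O.basis_spec s (mem_intEdges.1 hs).isNodeOrEdge (k s) (hka s (mem_intEdges.1 hs)).1 (a s)
  have hf0 : ∀ s ∈ P.intEdges, f s ≠ 0 := fun s hs => (hka s (mem_intEdges.1 hs)).2.1
  have hJL : ∀ s ∈ P.intEdges, JetL2 P.domain (J s) := fun s hs => by
    obtain ⟨C, hC⟩ := hlip s hs
    exact (hJ s hs).jetL2 hC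
  have hJb : ∀ s ∈ P.intEdges, ∫ x in P.domain, sqJ (J s) x ≤ 17 * |Cmax| * f s ^ 2 := by
    intro s hs
    have hi := mem_intEdges.1 hs
    obtain ⟨C, hC⟩ := hlip s hs
    have h1 := (hJ s hs).integral_sqJ_le (Finset.card_pos.1 (by rw [hi.2.1]; norm_num)) hC
      fun x hx => cutoff_eq_zero_of_notMem_nbhd (hVh s hs) (a s) hx
    have h2 : energy (P.nbhd s) (J s) ≤ Cmax * f s ^ 2 := (hka s hi).2.2
    have h3 := mul_le_mul_of_nonneg_right (le_abs_self Cmax) (sq_nonneg (f s))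
    linarith
  -- The coefficients that give the term of each edge the same flux through that edge as `φ`.
  set c : Finset Plane → ℝ := fun s => segFlux (A s) (B s) φ / f s with hc
  set u : Jet := ∑ s ∈ P.intEdges, c s • J s with hu
  have huL : JetL2 P.domain u := JetL2.sum fun s hs => (hJL s hs).const_smul (c s)
  obtain ⟨Cφ, hCφ⟩ := hφ.exists_lipschitzWith
  have hφL : JetL2 P.domain (jet φ) := jetL2_jet_of_lipschitz hCφ isBounded_domain
  refine ⟨u, ?_, huL, ?_, ?_⟩
  · refine Submodule.sum_mem _ fun s hs => Submodule.smul_mem _ _ (Submodule.subset_span ?_)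
    have hi := mem_intEdges.1 hs
    exact ⟨s, k s, a s, hi.isNodeOrEdge, (hka s hi).1, rfl⟩
  -- The constant is `306 = 3 · 17 · 6`: overlap, Poincaré bound, and flux bound. The squared flux
  -- `f s ^ 2` in the energy bound cancels against the denominator of `c s ^ 2`.
  · rw [huL.h1norm_sq, hφL.h1norm_sq]
    have h1 := integral_sqJ_sum_le (c := c) hJL fun s hs => (hJ s hs).1
    have h2 := sum_segFlux_sq_le hσ hφ hAB
    have h3 : ∑ s ∈ P.intEdges, c s ^ 2 * ∫ x in P.domain, sqJ (J s) x ≤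
        17 * |Cmax| * ∑ s ∈ P.intEdges, segFlux (A s) (B s) φ ^ 2 := by
      rw [Finset.mul_sum]
      refine Finset.sum_le_sum fun s hs => ?_
      refine (mul_le_mul_of_nonneg_left (hJb s hs) (sq_nonneg _)).trans_eq ?_
      have := hf0 s hs
      simp only [hc]
      field_simp
    have h4 := mul_le_mul_of_nonneg_left h2 (show 0 ≤ 17 * |Cmax| by positivity)
    linarith
  · intro p hp
    have hpL := memLp_of_mem_Qoff hp
    rw [setIntegral_domain_eq_sum (huL.integrable_divJ_mul hpL),
      setIntegral_domain_eq_sum (hφL.integrable_divJ_mul hpL)]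
    refine Finset.sum_congr rfl fun K hK => ?_
    obtain ⟨pK, hpK⟩ := hp.1 K hK
    have hcongr : ∀ J' : Jet, ∫ x in interior (P.block K), divJ J' x * p x =
        (∫ x in interior (P.block K), divJ J' x) * pK := by
      intro J'
      rw [← integral_mul_const]
      exact setIntegral_congr_fun isOpen_interior.measurableSet fun x hx => by
        simp only [hpK x hx]
    rw [hcongr, hcongr]
    congr 1
    -- The same coefficients express the mean divergence of `φ` and of every cut-off field on `K`,
    -- so orientations never have to be compared.
    obtain ⟨κ, hκ⟩ := Triangulation.exists_flux_coeff hK A B hAB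
    have hfin : IsFiniteMeasure (volume.restrict (interior (P.block K))) :=
      isFiniteMeasure_restrict.2 (isBounded_interior_block K).measure_lt_top.ne
    have hint : ∀ s ∈ P.intEdges, Integrable (fun x => c s * divJ (J s) x)
        (volume.restrict (interior (P.block K))) := fun s hs =>
      ((((hJL s hs).mono_set (interior_block_subset_domain K)).memLp_divJ).integrable
        (by norm_num)).const_mul _
    have hφK : ∫ x in interior (P.block K), divJ (jet φ) x =
        ∑ s ∈ K.powersetCard 2, κ s * segFlux (A s) (B s) φ := by
      rw [← hκ φ Cφ hCφ]
      refine (setIntegral_interior_block fun x hx hn => ?_).symm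
      simp [divJ, (eq_zero_of_isTest_domain hφ hK hx hn).2]
    rw [hφK, hu]
    simp only [divJ_sum_smul]
    rw [integral_finsetSum _ hint]
    have hterm : ∀ s ∈ P.intEdges, ∫ x in interior (P.block K), c s * divJ (J s) x =
        if s ⊆ K then κ s * segFlux (A s) (B s) φ else 0 := by
      intro s hs
      rw [integral_const_mul]
      split_ifs with hsK
      · obtain ⟨C, hC⟩ := hlip s hs
        rw [(hJ s hs).setIntegral_divJ hC hK hsK, setIntegral_divJ_cutoff O.pou
          (mem_intEdges.1 hs) (hVh s hs) (a s) hAB hK hsK hκ]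
        have := hf0 s hs
        change segFlux (A s) (B s) φ / f s * (κ s * f s) = _
        field_simp
      · rw [setIntegral_eq_zero_of_forall_eq_zero, mul_zero]
        intro x hx
        simp [divJ, ((hJ s hs).1 x (notMem_nbhd_of_not_subset hK hsK hx)).2]
    rw [Finset.sum_congr rfl hterm, ← Finset.sum_filter]
    -- A side of `K` that is not an interior edge does not meet the domain, so `φ` vanishes on it
    -- and its flux is zero.
    refine Finset.sum_subset ?_ ?_
    · intro s hs
      obtain ⟨h1, h2⟩ := Finset.mem_filter.1 hs
      exact Finset.mem_powersetCard.2 ⟨h2, (mem_intEdges.1 h1).2.1⟩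
    · intro s hs hns
      obtain ⟨hsK, h2⟩ := Finset.mem_powersetCard.1 hs
      have hface : s ∈ P.coarse.faces :=
        P.coarse.down_closed (P.coarse.mem_tri.1 hK).1 hsK (Finset.card_pos.1 (by omega))
      have hdisj : ∀ x ∈ hull s, x ∉ P.domain := fun x hx hxd =>
        hns (Finset.mem_filter.2 ⟨mem_intEdges.2 ⟨hface, h2, x, hx, hxd⟩, hsK⟩)
      have hz : segFlux (A s) (B s) φ = 0 := by
        unfold segFlux
        refine (intervalIntegral.integral_congr fun r hr => ?_).trans
          intervalIntegral.integral_zero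
        rw [Set.uIcc_of_le zero_le_one] at hr
        have hmem : A s + r • (B s - A s) ∈ hull s := by
          rw [hAB s h2, hull_pair, segment_eq_image', ← hAB s h2]
          exact ⟨r, hr, rfl⟩
        have h0 : φ (A s + r • (B s - A s)) = 0 :=
          (jet_eq_zero_of_notMem_tsupport fun ht => hdisj _ hmem (hφ.2.2 ht)).1
        simp [h0]
      rw [hz, mul_zero]

end PerforatedMesh

end PerforatedStokes

end

/-! ### From the continuous to the discrete inf-sup condition -/

open PerforatedStokes in
theorem mainTheorem1 (Ccont Cmax σ : ℝ) (hCcont : 0 < Ccont) :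
    ∃ Cinfsup : ℝ, 0 < Cinfsup ∧
      ∀ P : PerforatedMesh, P.ShapeRegular σ → ContinuousInfSup P.domain Ccont →
      ∀ O : P.OfflineData, O.FluxCondition Cmax →
      ∀ p ∈ P.Qoff,
        ((Cinfsup * l2norm P.domain p : ℝ) : EReal) ≤
          infSupQuotient P.domain (O.Voff : Set Jet) p := by
  -- The norm of the Fortin operator. The absolute values allow arbitrary real parameters and the
  -- added one keeps `C` positive.
  set C : ℝ := Real.sqrt (306 * |Cmax| * |σ|) + 1 with hC
  have hC0 : 0 < C := by positivity
  -- The factor `8` is `2 · 4`: a half makes the supremum strictly exceed the bound, so that some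
  -- field attains it, and a quarter is lost in passing to a test field.
  refine ⟨Ccont / (8 * C), by positivity, fun P hσ hcont O hO p hp => ?_⟩
  have hpL := PerforatedMesh.memLp_of_mem_Qoff hp
  rcases (l2norm_nonneg P.domain p).eq_or_lt with h0 | hpos
  · rw [← h0, mul_zero]
    refine le_iSup₂_of_le (0 : Jet) (Submodule.zero_mem _) ?_
    simp [divJ]
  have hlt : ((Ccont / 2 * l2norm P.domain p : ℝ) : EReal) <
      infSupQuotient P.domain (H10 P.domain) p := by
    refine lt_of_lt_of_le ?_ (hcont p hpL hp.2)
    rw [EReal.coe_lt_coe_iff]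
    nlinarith
  obtain ⟨v, hv⟩ := lt_iSup_iff.1 hlt
  obtain ⟨hvH, hv⟩ := lt_iSup_iff.1 hv
  rw [EReal.coe_lt_coe_iff] at hv
  obtain ⟨φ, hφ, hIpos, hIle⟩ := exists_isTest_of_lt_quotient PerforatedMesh.isBounded_domain hvH
    hpL (by positivity) hv
  obtain ⟨u, huV, huL, hub, hup⟩ := O.exists_mem_Voff hσ hO hφ
  have hI := hup p hp
  have hn : h1norm P.domain u ≤ C * h1norm P.domain (jet φ) := by
    have hφ0 := h1norm_nonneg P.domain (jet φ)
    refine (abs_le_of_sq_le_sq' (hub.trans ?_) (by positivity)).2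
    rw [mul_pow]
    refine mul_le_mul_of_nonneg_right ?_ (sq_nonneg _)
    have h1 := Real.sq_sqrt (show 0 ≤ 306 * |Cmax| * |σ| by positivity)
    have h2 := Real.sqrt_nonneg (306 * |Cmax| * |σ|)
    rw [hC]
    nlinarith
  -- The pairing of `u` with `p` equals that of `φ`, which is positive, so `u` cannot have zero
  -- norm.
  have hun : 0 < h1norm P.domain u := by
    refine (h1norm_nonneg _ _).lt_of_ne fun h0 => ?_
    have h1 := huL.sq_integral_divJ_mul_le hpL
    rw [← h0, hI] at h1
    nlinarith
  refine le_iSup₂_of_le u huV ?_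
  rw [EReal.coe_le_coe_iff, le_div_iff₀ hun, hI]
  refine le_trans ?_ hIle
  have h1 : Ccont / (8 * C) * l2norm P.domain p * h1norm P.domain u ≤
      Ccont / (8 * C) * l2norm P.domain p * (C * h1norm P.domain (jet φ)) :=
    mul_le_mul_of_nonneg_left hn (by positivity)
  refine h1.trans_eq ?_
  field_simp
  ring
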